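/- Let $\alpha>-1/2$, let $\mathbb R^+=[0,\infty)$, let $d\mu_\alpha(x)=(2\pi)^{\alpha+1}x^{2\alpha+1}\,dx$ on $\mathbb R^+$, and let $L^p_\alpha=L^p(\mathbb R^+,\mu_\alpha)$ (complex-valued functions). Put $$j_\alpha(x)=\frac1{2^\alpha}\sum_{n=0}^\infty\frac{(-1)^n}{n!\,\Gamma(n+\alpha+1)}\Big(\frac x2\Big)^{2n},$$ and let $\mathcal F_\alpha$ be the Fourier--Bessel transform on $L^2_\alpha$, that is, the unique linear isometry of $L^2_\alpha$ into itself with $$\mathcal F_\alpha(f)(y)=\int_0^\infty f(x)\,j_\alpha(2\pi xy)\,d\mu_\alpha(x)\quad\text{for almost every } y,\qquad f\in L^1_\alpha\cap L^2_\alpha$$ (part of the assertion is that this isometry exists). Let $S,\Sigma\subset\mathbb R^+$ be measurable sets. Assume that either 1. the Lebesgue measures of $S$ and $\Sigma$ satisfy $0<|S|<\infty$ and $0<|\Sigma|<\infty$, or 2. $\mu_\alpha(S)<\infty$ and $\mu_\alpha(\Sigma)<\infty$. Then $(S,\Sigma)$ is a strong annihilating pair for $\mathcal F_\alpha$: there is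 a constant $C=C_\alpha(S,\Sigma)$ such that for all $f\in L^2_\alpha$ $$\|f\|_{L^2_\alpha}\le C\Big(\|f\|_{L^2_\alpha(\mathbb R^+\setminus S)}+\|\mathcal F_\alpha(f)\|_{L^2_\alpha(\mathbb R^+\setminus\Sigma)}\Big).$$ -/

import Mathlib

open MeasureTheory

noncomputable section

/-- The normalized Bessel function
`j_α(x) = J_α(x) / x^α = 2^{-α} ∑ₙ (-1)ⁿ / (n! Γ(n + α + 1)) (x / 2)^{2n}`. -/
def besselj (α x : ℝ) : ℝ :=
  (1 / (2 : ℝ) ^ α) *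
    ∑' n : ℕ, ((-1 : ℝ) ^ n / ((n.factorial : ℝ) * Real.Gamma ((n : ℝ) + α + 1))) *
      (x / 2) ^ (2 * n)

/-- The measure `dμ_α(x) = (2π)^{α+1} x^{2α+1} dx` on `ℝ⁺`, regarded as a measure on `ℝ`
that is carried by the half-line. -/
def besselMeasure (α : ℝ) : Measure ℝ :=
  (volume.restrict (Set.Ici (0 : ℝ))).withDensity
    (fun x => ENNReal.ofReal ((2 * Real.pi) ^ (α + 1) * x ^ (2 * α + 1)))

/-- The Hilbert space `L²_α(ℝ⁺)` of complex-valued functions. -/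
abbrev L2Bessel (α : ℝ) : Type := Lp ℂ 2 (besselMeasure α)

/-- The integral `∫₀^∞ f(x) j_α(2πxy) dμ_α(x)`, i.e. the Fourier–Bessel transform of
`f ∈ L¹_α(ℝ⁺)` at `y`. -/
def fourierBessel (α : ℝ) (f : ℝ → ℂ) (y : ℝ) : ℂ :=
  ∫ x, f x * (besselj α (2 * Real.pi * x * y) : ℂ) ∂(besselMeasure α)

/-- `F` is the extension of the Fourier–Bessel transform to an isometry of `L²_α(ℝ⁺)`: it is
given by the integral on `L¹_α ∩ L²_α`. As this subspace is dense, there is at most one such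
`F`; see `IsFourierBesselL2.unique`. -/
def IsFourierBesselL2 (α : ℝ) (F : L2Bessel α →ₗᵢ[ℂ] L2Bessel α) : Prop :=
  ∀ f : L2Bessel α, Integrable f (besselMeasure α) →
    F f =ᵐ[besselMeasure α] fourierBessel α f

theorem IsFourierBesselL2.unique {α : ℝ} {F G : L2Bessel α →ₗᵢ[ℂ] L2Bessel α}
    (hF : IsFourierBesselL2 α F) (hG : IsFourierBesselL2 α G) : F = G := by
  have hd : DenseRange ((↑) : Lp.simpleFunc ℂ 2 (besselMeasure α) → L2Bessel α) :=
    Lp.simpleFunc.denseRange (by simp)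
  have h : (F : L2Bessel α → L2Bessel α) = G := by
    refine hd.equalizer F.continuous G.continuous (funext fun s => ?_)
    have hs : Integrable (s : L2Bessel α) (besselMeasure α) := by
      have h1 : MemLp (Lp.simpleFunc.toSimpleFunc s) 2 (besselMeasure α) :=
        Lp.simpleFunc.memLp s
      have h2 : Integrable (Lp.simpleFunc.toSimpleFunc s) (besselMeasure α) :=
        (SimpleFunc.memLp_iff_integrable (by simp) (by simp)).1 h1
      exact h2.congr (Lp.simpleFunc.toSimpleFunc_eq_toFun s)
    exact Lp.ext ((hF _ hs).trans (hG _ hs).symm)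
  exact DFunLike.coe_injective h

/-- The norm of `L²_α(A)` applied to (the restriction to `A` of) `f ∈ L²_α(ℝ⁺)`. -/
def normOn (α : ℝ) (A : Set ℝ) (f : L2Bessel α) : ℝ :=
  (eLpNorm f 2 ((besselMeasure α).restrict A)).toReal

/-- `(S, T)` is a strong annihilating pair for the Fourier–Bessel transform: there is a constant
`C`, which depends on `α`, `S` and `T` only, with
`‖f‖ ≤ C (‖f‖_{L²_α(ℝ⁺ ∖ S)} + ‖F f‖_{L²_α(ℝ⁺ ∖ T)})` for all `f ∈ L²_α(ℝ⁺)`, where `F` is the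
Fourier–Bessel transform on `L²_α(ℝ⁺)`. The existence of `F` is part of the assertion. -/
def IsStrongAnnihilatingPair (α : ℝ) (S T : Set ℝ) : Prop :=
  ∃ F : L2Bessel α →ₗᵢ[ℂ] L2Bessel α, IsFourierBesselL2 α F ∧
    ∃ C : ℝ, ∀ f : L2Bessel α,
      ‖f‖ ≤ C * (normOn α (Set.Ici 0 \ S) f + normOn α (Set.Ici 0 \ T) (F f))

end

/-! Only finite Lebesgue measure matters: since `2 * α + 1 > 0`, the density of `μ_α` is bounded
below on `[1, ∞)`, so the second case reduces to the argument for the first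
(`volume_lt_top_of_besselMeasure_lt_top`).

The isometry is built on Gaussians. Termwise integration sends `exp (-π s x²)` to `s^{-(α+1)} exp
(-π x² / s)`, and this map preserves inner products. Gaussians span a dense subspace by uniqueness
for the Laplace transform in `x²`, so the map extends to `L²_α`. Testing against Gaussians, with
Fubini, shows that the extension is the integral on `L¹_α ∩ L²_α` (`exists_isFourierBesselL2`).

The analytic core is `|j_α(x)| ≤ C x^{-(α+1/2)}` (`besselj_bounds`). The square of this decay
cancels the weight `x^{2α+1}` in each of the two variables, so the kernel restricted to `S × T` has
squared Hilbert–Schmidt norm `O(|S| |T|)`. The resulting compactness is used in sequential form: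
weak convergence gives pointwise convergence of the transforms, and dominated convergence upgrades
it to norm convergence (`IsFourierBesselL2.exists_subseq_tendsto`). In particular, the functions
living on `S` with transform living on `T` form a finite-dimensional space.

This space is zero by a dilation argument. Let `f` belong to it and have support `S`. Dilates of `f`
by factors `c n < 1` tending to `1` fast enough all lie in one such finite-dimensional space, for
slightly larger sets. Hence some dilate lies in the span of arbitrarily late ones. Its support has
measure `|S| / c`, yet is covered by sets whose union has measure at most `|S|` plus the tail of a
convergent series, so `|S| = 0` (`IsFourierBesselL2.volume_support_eq_zero`).

The quantitative inequality follows by compactness: normalized counterexamples would converge along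
a subsequence to a nonzero element of the zero space. -/

open Filter Topology

/-! ### The entire function `z ↦ ∑ (-1)ⁿ zⁿ / (n! Γ(n + ν + 1))` -/

/-- The coefficients of `besselSeries`. -/
noncomputable def besselCoeff (ν : ℝ) (n : ℕ) : ℝ :=
  (-1 : ℝ) ^ n / ((n.factorial : ℝ) * Real.Gamma ((n : ℝ) + ν + 1))

/-- The entire function `z ↦ ∑ (-1)ⁿ zⁿ / (n! Γ(n + ν + 1))`. -/
noncomputable def besselSeries (ν z : ℝ) : ℝ := ∑' n : ℕ, besselCoeff ν n * z ^ n

theorem besselj_eq_besselSeries (α x : ℝ) :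
    besselj α x = (1 / (2 : ℝ) ^ α) * besselSeries α ((x / 2) ^ 2) := by
  simp only [besselj, besselSeries, besselCoeff, pow_mul]

/-- `Γ` is not monotone on `(0, ∞)`, but from `Γ(ν + 2)` on, each unit step multiplies by a factor
larger than `1`. The first two values therefore bound all the others from below. -/
theorem abs_besselCoeff_le {ν : ℝ} (hν : -1 < ν) :
    ∃ K : ℝ, 0 ≤ K ∧ ∀ n : ℕ, |besselCoeff ν n| ≤ K / n.factorial := by
  set m : ℝ := min (Real.Gamma (ν + 1)) (Real.Gamma (ν + 2)) with hm
  have hm0 : 0 < m := lt_min (Real.Gamma_pos_of_pos (by linarith))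
    (Real.Gamma_pos_of_pos (by linarith))
  have hG : ∀ n : ℕ, m ≤ Real.Gamma ((n : ℝ) + 1 + ν + 1) := by
    intro n
    induction n with
    | zero =>
      refine (min_le_right _ _).trans (le_of_eq ?_)
      congr 1
      push_cast
      ring
    | succ k ih =>
      have hk : (0 : ℝ) ≤ k := k.cast_nonneg
      push_cast
      rw [show (k : ℝ) + 1 + 1 + ν + 1 = ((k : ℝ) + 1 + ν + 1) + 1 by ring,
        Real.Gamma_add_one (by linarith)]
      nlinarith
  have hG' : ∀ n : ℕ, m ≤ Real.Gamma ((n : ℝ) + ν + 1) := by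
    intro n
    cases n with
    | zero =>
      rw [Nat.cast_zero, zero_add]
      exact min_le_left _ _
    | succ k => simpa using hG k
  refine ⟨1 / m, by positivity, fun n => ?_⟩
  have hf : (0 : ℝ) < n.factorial := by exact_mod_cast n.factorial_pos
  have hpos : 0 < Real.Gamma ((n : ℝ) + ν + 1) := hm0.trans_le (hG' n)
  rw [besselCoeff, abs_div, abs_pow, abs_neg, abs_one, one_pow, abs_of_pos (mul_pos hf hpos),
    div_div]
  refine one_div_le_one_div_of_le (by positivity) ?_
  rw [mul_comm]
  exact mul_le_mul_of_nonneg_left (hG' n) hf.le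

theorem summable_abs_besselCoeff_mul_pow {ν : ℝ} (hν : -1 < ν) (z : ℝ) :
    Summable fun n : ℕ => |besselCoeff ν n * z ^ n| := by
  obtain ⟨K, hK, h⟩ := abs_besselCoeff_le hν
  refine Summable.of_nonneg_of_le (fun _ => abs_nonneg _) (fun n => ?_)
    ((Real.summable_pow_div_factorial |z|).mul_left K)
  rw [abs_mul, abs_pow]
  calc |besselCoeff ν n| * |z| ^ n ≤ K / n.factorial * |z| ^ n := by gcongr; exact h n
    _ = K * (|z| ^ n / n.factorial) := by ring

theorem summable_besselCoeff_mul_pow {ν : ℝ} (hν : -1 < ν) (z : ℝ) :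
    Summable fun n : ℕ => besselCoeff ν n * z ^ n :=
  (summable_abs_besselCoeff_mul_pow hν z).of_abs

theorem besselCoeff_succ_mul (ν : ℝ) (n : ℕ) :
    besselCoeff ν (n + 1) * ((n : ℝ) + 1) = -besselCoeff (ν + 1) n := by
  have hf : (n.factorial : ℝ) ≠ 0 := by exact_mod_cast n.factorial_ne_zero
  have hn : (n : ℝ) + 1 ≠ 0 := by positivity
  simp only [besselCoeff, Nat.factorial_succ]
  push_cast
  rw [show (n : ℝ) + 1 + ν + 1 = (n : ℝ) + (ν + 1) + 1 by ring]
  by_cases hG : Real.Gamma ((n : ℝ) + (ν + 1) + 1) = 0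
  · simp [hG]
  · field_simp
    ring

theorem hasDerivAt_besselSeries {ν : ℝ} (hν : -1 < ν) (z : ℝ) :
    HasDerivAt (besselSeries ν) (-besselSeries (ν + 1) z) z := by
  obtain ⟨K, hK, hc⟩ := abs_besselCoeff_le (ν := ν + 1) (by linarith)
  set R : ℝ := |z| + 1 with hR
  -- At `n = 0` the truncated subtraction gives the bound `K`, which is harmless because the
  -- differentiated term is zero there.
  have hsum : Summable fun n : ℕ => K * (R ^ (n - 1) / (n - 1).factorial) := by
    refine Summable.mul_left K ?_
    rw [← summable_nat_add_iff 1]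
    simpa using Real.summable_pow_div_factorial R
  have hterm : ∀ (n : ℕ) (y : ℝ), besselCoeff ν (n + 1) * (((n + 1 : ℕ) : ℝ) * y ^ n)
      = -(besselCoeff (ν + 1) n * y ^ n) := by
    intro n y
    rw [← mul_assoc]
    push_cast
    rw [besselCoeff_succ_mul]
    ring
  have key := hasDerivAt_tsum_of_isPreconnected (𝕜 := ℝ)
    (g := fun (n : ℕ) (y : ℝ) => besselCoeff ν n * y ^ n)
    (g' := fun (n : ℕ) (y : ℝ) => besselCoeff ν n * ((n : ℝ) * y ^ (n - 1)))
    (t := Metric.ball (0 : ℝ) R) (y₀ := 0) (y := z) hsum Metric.isOpen_ball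
    (convex_ball _ _).isPreconnected
    (fun n y _ => (hasDerivAt_pow n y).const_mul _)
    (fun n y hy => by
      have hy' : |y| ≤ R := by
        have := Metric.mem_ball.1 hy
        rw [Real.dist_eq, sub_zero] at this
        exact this.le
      cases n with
      | zero => simp; positivity
      | succ k =>
        simp only [Nat.add_sub_cancel]
        rw [hterm, norm_neg, Real.norm_eq_abs, abs_mul, abs_pow]
        calc |besselCoeff (ν + 1) k| * |y| ^ k ≤ K / k.factorial * R ^ k := by
              gcongr
              exact hc k
          _ = K * (R ^ k / k.factorial) := by ring)
    (by simp [hR]; positivity) (summable_besselCoeff_mul_pow hν 0)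
    (by simp [hR])
  have hval : (∑' n : ℕ, besselCoeff ν n * ((n : ℝ) * z ^ (n - 1))) = -besselSeries (ν + 1) z := by
    have hs : Summable fun n : ℕ => besselCoeff ν (n + 1) * (((n + 1 : ℕ) : ℝ) * z ^ n) := by
      simp only [hterm]
      exact (summable_besselCoeff_mul_pow (by linarith) z).neg
    rw [tsum_eq_zero_add' (by simpa using hs)]
    simp only [Nat.cast_zero, zero_mul, mul_zero, zero_add, Nat.add_sub_cancel, hterm, tsum_neg,
      besselSeries]
  rw [← hval]
  exact key

theorem continuous_besselSeries {ν : ℝ} (hν : -1 < ν) : Continuous (besselSeries ν) :=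
  continuous_iff_continuousAt.2 fun z => (hasDerivAt_besselSeries hν z).continuousAt

/-- Comparison of coefficients via `Γ(x + 1) = x Γ(x)`. Together with the derivative formula it
encodes Bessel's differential equation. -/
theorem besselSeries_recurrence {ν : ℝ} (hν : -1 < ν) (z : ℝ) :
    (ν + 1) * besselSeries (ν + 1) z - z * besselSeries (ν + 2) z = besselSeries ν z := by
  have h1 := summable_besselCoeff_mul_pow (ν := ν + 1) (by linarith) z
  have h2 := summable_besselCoeff_mul_pow (ν := ν + 2) (by linarith) z
  have h0 := summable_besselCoeff_mul_pow hν z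
  have e0 : ∀ n : ℕ, besselCoeff ν n = ((n : ℝ) + ν + 1) * besselCoeff (ν + 1) n := by
    intro n
    have hn : (0 : ℝ) ≤ n := n.cast_nonneg
    have hp : 0 < (n : ℝ) + ν + 1 := by linarith
    have hG := (Real.Gamma_pos_of_pos hp).ne'
    have hf : (n.factorial : ℝ) ≠ 0 := by exact_mod_cast n.factorial_ne_zero
    simp only [besselCoeff]
    rw [show (n : ℝ) + (ν + 1) + 1 = ((n : ℝ) + ν + 1) + 1 by ring, Real.Gamma_add_one hp.ne']
    field_simp
  have e2 : ∀ n : ℕ, besselCoeff (ν + 1) (n + 1) * ((n : ℝ) + 1) = -besselCoeff (ν + 2) n := by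
    intro n
    rw [besselCoeff_succ_mul]
    congr 2
    ring
  have hs0 : Summable fun n : ℕ => besselCoeff ν (n + 1) * z ^ (n + 1) :=
    (summable_nat_add_iff 1).2 h0
  have hs1 : Summable fun n : ℕ => besselCoeff (ν + 1) (n + 1) * z ^ (n + 1) :=
    (summable_nat_add_iff 1).2 h1
  simp only [besselSeries]
  rw [h0.tsum_eq_zero_add, h1.tsum_eq_zero_add, mul_add, ← tsum_mul_left, ← tsum_mul_left,
    add_sub_assoc, ← (hs1.mul_left (ν + 1)).tsum_sub (h2.mul_left z)]
  congr 1
  · rw [e0 0]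
    push_cast
    ring
  · refine tsum_congr fun n => ?_
    have := e2 n
    rw [e0 (n + 1), ← neg_eq_iff_eq_neg.2 this]
    push_cast
    ring

/-! ### Bounds for the normalized Bessel function -/

theorem continuous_besselj {α : ℝ} (hα : -1 < α) : Continuous (besselj α) := by
  have : besselj α = fun x => (1 / (2 : ℝ) ^ α) * besselSeries α ((x / 2) ^ 2) :=
    funext (besselj_eq_besselSeries α)
  rw [this]
  have := continuous_besselSeries hα
  fun_prop

/-- The function `x ↦ x^{α + 1/2} P_α(x²/4)` is bounded on `[1, ∞)`: it solves
`u'' + u = (α² - 1/4) u / x²`, so its energy `u'² + u²`, multiplied by `exp (|α² - 1/4| / x)`,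
is nonincreasing. -/
theorem rpow_mul_besselSeries_bounded {α : ℝ} (hα : -1 < α) :
    ∃ C : ℝ, ∀ x : ℝ, 1 ≤ x → |x ^ (α + 1 / 2) * besselSeries α ((x / 2) ^ 2)| ≤ C := by
  set β : ℝ := α + 1 / 2 with hβ
  -- `β (β - 1) = α² - 1/4`. Below, `v` is `u'`, and the cross term in the derivative of `v² + u²`
  -- is absorbed by differentiating `exp (K / x)`.
  set K : ℝ := |β * (β - 1)| with hK
  have hd : ∀ {ν : ℝ}, -1 < ν → ∀ x : ℝ, HasDerivAt (fun x => besselSeries ν ((x / 2) ^ 2))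
      (-(x / 2) * besselSeries (ν + 1) ((x / 2) ^ 2)) x := by
    intro ν hν x
    have h1 : HasDerivAt (fun x : ℝ => (x / 2) ^ 2) (x / 2) x := by
      have := ((hasDerivAt_id x).div_const 2).pow 2
      refine this.congr_deriv ?_
      simp
      ring
    have := (hasDerivAt_besselSeries hν ((x / 2) ^ 2)).comp x h1
    refine this.congr_deriv ?_
    ring
  set g0 : ℝ → ℝ := fun x => besselSeries α ((x / 2) ^ 2) with hg0
  set g1 : ℝ → ℝ := fun x => besselSeries (α + 1) ((x / 2) ^ 2) with hg1
  set g2 : ℝ → ℝ := fun x => besselSeries (α + 2) ((x / 2) ^ 2) with hg2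
  have d0 : ∀ x, HasDerivAt g0 (-(x / 2) * g1 x) x := hd hα
  have d1 : ∀ x, HasDerivAt g1 (-(x / 2) * g2 x) x := by
    intro x
    have := hd (ν := α + 1) (by linarith) x
    rwa [show α + 1 + 1 = α + 2 by ring] at this
  have hrec : ∀ x, (α + 1) * g1 x - (x / 2) ^ 2 * g2 x = g0 x :=
    fun x => besselSeries_recurrence hα _
  set u : ℝ → ℝ := fun x => x ^ β * g0 x with hu
  set v : ℝ → ℝ := fun x => β * x ^ (β - 1) * g0 x - x ^ β * (x / 2) * g1 x with hv
  have du : ∀ x, 0 < x → HasDerivAt u (v x) x := by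
    intro x hx
    have := (Real.hasDerivAt_rpow_const (p := β) (Or.inl hx.ne')).mul (d0 x)
    refine this.congr_deriv ?_
    simp only [hv]
    ring
  have dv : ∀ x, 0 < x → HasDerivAt v (β * (β - 1) / x ^ 2 * u x - u x) x := by
    intro x hx
    have h1 := ((Real.hasDerivAt_rpow_const (x := x) (p := β - 1) (Or.inl hx.ne')).const_mul β).mul
      (d0 x)
    have h2 := (((Real.hasDerivAt_rpow_const (x := x) (p := β) (Or.inl hx.ne')).mul
      ((hasDerivAt_id x).div_const 2))).mul (d1 x)
    have h3 := h1.sub h2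
    refine h3.congr_deriv ?_
    simp only [hu, id, Pi.mul_apply]
    rw [← hrec x]
    have r1 : x ^ (β - 1) = x ^ β / x := by rw [Real.rpow_sub hx, Real.rpow_one]
    have r2 : x ^ (β - 1 - 1) = x ^ β / x ^ 2 := by
      rw [Real.rpow_sub hx, Real.rpow_sub hx, Real.rpow_one]
      field_simp
    rw [r1, r2]
    have : α = β - 1 / 2 := by rw [hβ]; ring
    rw [this]
    field_simp
    ring
  set H : ℝ → ℝ := fun x => (v x ^ 2 + u x ^ 2) * Real.exp (K / x) with hH
  have dH : ∀ x, 0 < x → HasDerivAt H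
      ((2 * (β * (β - 1)) * (u x * v x) - K * (v x ^ 2 + u x ^ 2)) / x ^ 2 *
        Real.exp (K / x)) x := by
    intro x hx
    have h1 := ((dv x hx).pow 2).add ((du x hx).pow 2)
    have h2 : HasDerivAt (fun x : ℝ => Real.exp (K / x)) (Real.exp (K / x) * (-K / x ^ 2)) x := by
      refine HasDerivAt.exp ?_
      have := (hasDerivAt_inv hx.ne').const_mul K
      refine this.congr_deriv ?_
      field_simp
    have h3 := h1.mul h2
    refine h3.congr_deriv ?_
    simp only [Pi.add_apply, Pi.pow_apply]
    field_simp
    push_cast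
    ring
  have hanti : AntitoneOn H (Set.Ici 1) := by
    refine antitoneOn_of_deriv_nonpos (convex_Ici 1) ?_ ?_ ?_
    · intro x hx
      exact (dH x (by linarith [Set.mem_Ici.1 hx])).continuousAt.continuousWithinAt
    · intro x hx
      rw [interior_Ici] at hx
      exact (dH x (by linarith [Set.mem_Ioi.1 hx])).differentiableAt.differentiableWithinAt
    · intro x hx
      rw [interior_Ici] at hx
      have hx0 : 0 < x := by linarith [Set.mem_Ioi.1 hx]
      rw [(dH x hx0).deriv]
      refine mul_nonpos_of_nonpos_of_nonneg (div_nonpos_of_nonpos_of_nonneg ?_ (sq_nonneg _))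
        (Real.exp_pos _).le
      have h1 : 2 * (β * (β - 1)) * (u x * v x) ≤ K * (2 * (|u x| * |v x|)) := by
        calc 2 * (β * (β - 1)) * (u x * v x) ≤ |2 * (β * (β - 1)) * (u x * v x)| := le_abs_self _
          _ = K * (2 * (|u x| * |v x|)) := by
            rw [abs_mul, abs_mul, abs_mul (u x), abs_two]
            ring
      have h2 : 2 * (|u x| * |v x|) ≤ v x ^ 2 + u x ^ 2 := by
        rw [← sq_abs (v x), ← sq_abs (u x)]
        nlinarith [sq_nonneg (|u x| - |v x|)]
      have h3 := mul_le_mul_of_nonneg_left h2 (abs_nonneg (β * (β - 1)))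
      linarith
  refine ⟨Real.sqrt (H 1), fun x hx => Real.le_sqrt_of_sq_le ?_⟩
  have h1 : H x ≤ H 1 := hanti (Set.mem_Ici.2 le_rfl) hx hx
  have h2 : v x ^ 2 + u x ^ 2 ≤ H x := by
    refine le_mul_of_one_le_right (by positivity) (Real.one_le_exp ?_)
    have : 0 ≤ K := abs_nonneg _
    positivity
  rw [sq_abs]
  calc u x ^ 2 ≤ v x ^ 2 + u x ^ 2 := by nlinarith [sq_nonneg (v x)]
    _ ≤ H 1 := h2.trans h1

theorem besselj_abs (α x : ℝ) : besselj α |x| = besselj α x := by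
  rw [besselj_eq_besselSeries, besselj_eq_besselSeries, div_pow, div_pow, sq_abs]

/-- The energy estimate covers `[1, ∞)` and continuity covers `[0, 1]`. As the exponent `-(α + 1/2)`
is negative, the power is at least `1` on `(0, 1]` and at most `1` on `[1, ∞)`, so each bound
extends to the other range. -/
theorem besselj_bounds {α : ℝ} (hα : -1 / 2 < α) :
    ∃ C : ℝ, 0 ≤ C ∧ (∀ x : ℝ, |besselj α x| ≤ C) ∧
      ∀ x : ℝ, 0 < x → |besselj α x| ≤ C * x ^ (-(α + 1 / 2)) := by
  obtain ⟨C₁, h₁⟩ := rpow_mul_besselSeries_bounded (α := α) (by linarith)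
  obtain ⟨C₂, h₂⟩ := (isCompact_Icc (a := (0 : ℝ)) (b := 1)).exists_bound_of_continuousOn
    (continuous_besselj (α := α) (by linarith)).continuousOn
  have h2α : 0 < 1 / (2 : ℝ) ^ α := by positivity
  set C₃ : ℝ := 1 / (2 : ℝ) ^ α * C₁ with hC₃
  have hdecay : ∀ x : ℝ, 1 ≤ x → |besselj α x| ≤ C₃ * x ^ (-(α + 1 / 2)) := by
    intro x hx
    have hx0 : 0 < x := by linarith
    have hp : 0 < x ^ (α + 1 / 2) := Real.rpow_pos_of_pos hx0 _
    have := h₁ x hx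
    rw [abs_mul, abs_of_pos hp] at this
    rw [besselj_eq_besselSeries, abs_mul, abs_of_pos h2α, hC₃, Real.rpow_neg hx0.le, mul_assoc]
    refine mul_le_mul_of_nonneg_left ?_ h2α.le
    rw [← div_eq_mul_inv, le_div_iff₀ hp]
    linarith
  have hC₂ : 0 ≤ C₂ := (norm_nonneg _).trans (h₂ 0 (by simp))
  have hC₃0 : 0 ≤ C₃ := by
    have := (abs_nonneg _).trans (hdecay 1 le_rfl)
    simpa using this
  have hC : ∀ x : ℝ, 0 ≤ x → x ≤ 1 → |besselj α x| ≤ C₂ := fun x h0 h1 => h₂ x ⟨h0, h1⟩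
  refine ⟨max C₂ C₃, le_max_of_le_left hC₂, fun x => ?_, fun x hx => ?_⟩
  · rw [← besselj_abs]
    generalize hy : |x| = y
    have hx : 0 ≤ y := hy ▸ abs_nonneg x
    rcases le_total y 1 with h | h
    · exact (hC y hx h).trans (le_max_left _ _)
    · refine (hdecay y h).trans ((mul_le_of_le_one_right hC₃0 ?_).trans (le_max_right _ _))
      exact Real.rpow_le_one_of_one_le_of_nonpos h (by linarith)
  · have hp : 0 < x ^ (-(α + 1 / 2)) := Real.rpow_pos_of_pos hx _
    rcases le_total x 1 with h | h
    · refine (hC x hx.le h).trans ((le_max_left C₂ C₃).trans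
        (le_mul_of_one_le_right (le_max_of_le_left hC₂) ?_))
      exact Real.one_le_rpow_of_pos_of_le_one_of_nonpos hx h (by linarith)
    · exact (hdecay x h).trans (mul_le_mul_of_nonneg_right (le_max_right _ _) hp.le)

/-! ### The measure `μ_α` -/

/-- The density of `μ_α`. -/
noncomputable def besselWeight (α x : ℝ) : ℝ := (2 * Real.pi) ^ (α + 1) * x ^ (2 * α + 1)

theorem measurable_besselWeight (α : ℝ) : Measurable (besselWeight α) := by
  unfold besselWeight
  fun_prop

theorem besselWeight_pos (α : ℝ) {x : ℝ} (hx : 0 < x) : 0 < besselWeight α x := by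
  have := Real.pi_pos
  unfold besselWeight
  positivity

theorem besselMeasure_eq_withDensity_Ioi (α : ℝ) :
    besselMeasure α = (volume.restrict (Set.Ioi (0 : ℝ))).withDensity
      (fun x => ENNReal.ofReal (besselWeight α x)) := by
  rw [besselMeasure, ← restrict_Ioi_eq_restrict_Ici]
  rfl

instance sigmaFinite_besselMeasure (α : ℝ) : SigmaFinite (besselMeasure α) := by
  rw [besselMeasure_eq_withDensity_Ioi]
  exact SigmaFinite.withDensity_ofReal _

/-- The density is positive on `(0, ∞)`, so there `μ_α` and Lebesgue measure have the same null
sets. -/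
theorem ae_besselMeasure_iff (α : ℝ) {p : ℝ → Prop} :
    (∀ᵐ x ∂(besselMeasure α), p x) ↔ ∀ᵐ x : ℝ, 0 < x → p x := by
  rw [besselMeasure_eq_withDensity_Ioi,
    ae_withDensity_iff (measurable_besselWeight α).ennreal_ofReal,
    ae_restrict_iff' measurableSet_Ioi]
  refine Filter.eventually_congr (Filter.Eventually.of_forall fun x => ?_)
  constructor
  · intro h hx
    exact h hx (by simpa using besselWeight_pos α hx)
  · intro h hx _
    exact h hx

theorem ae_besselMeasure_pos (α : ℝ) : ∀ᵐ x ∂(besselMeasure α), 0 < x :=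
  (ae_besselMeasure_iff α).2 (Filter.Eventually.of_forall fun _ h => h)

theorem integrable_besselMeasure_iff {E : Type*} [NormedAddCommGroup E] [NormedSpace ℝ E]
    (α : ℝ) {g : ℝ → E} :
    Integrable g (besselMeasure α) ↔
      IntegrableOn (fun x => besselWeight α x • g x) (Set.Ioi 0) := by
  rw [besselMeasure_eq_withDensity_Ioi, integrable_withDensity_iff_integrable_smul'
    (measurable_besselWeight α).ennreal_ofReal (by simp), IntegrableOn]
  refine integrable_congr ?_
  filter_upwards [ae_restrict_mem measurableSet_Ioi] with x hx
  rw [ENNReal.toReal_ofReal (besselWeight_pos α hx).le]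

theorem integral_besselMeasure {E : Type*} [NormedAddCommGroup E] [NormedSpace ℝ E]
    (α : ℝ) (g : ℝ → E) :
    ∫ x, g x ∂(besselMeasure α) = ∫ x in Set.Ioi (0 : ℝ), besselWeight α x • g x := by
  rw [besselMeasure_eq_withDensity_Ioi, integral_withDensity_eq_integral_toReal_smul₀
    (measurable_besselWeight α).ennreal_ofReal.aemeasurable (by simp)]
  refine integral_congr_ae ?_
  filter_upwards [ae_restrict_mem measurableSet_Ioi] with x hx
  rw [ENNReal.toReal_ofReal (besselWeight_pos α hx).le]

/-! ### Gaussians -/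

/-- The Gaussian `x ↦ exp (-π s x²)`. -/
noncomputable def gauss (s x : ℝ) : ℝ := Real.exp (-(Real.pi * s) * x ^ 2)

theorem continuous_gauss (s : ℝ) : Continuous (gauss s) := by
  unfold gauss
  fun_prop

theorem gauss_pos (s x : ℝ) : 0 < gauss s x := Real.exp_pos _

theorem gauss_mul_gauss (s t x : ℝ) : gauss s x * gauss t x = gauss (s + t) x := by
  rw [gauss, gauss, gauss, ← Real.exp_add]
  congr 1
  ring

theorem weight_mul_pow_mul_gauss (α s : ℝ) (n : ℕ) {x : ℝ} (hx : 0 < x) :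
    besselWeight α x * (x ^ (2 * n) * gauss s x) =
      (2 * Real.pi) ^ (α + 1) *
        (x ^ (2 * α + 1 + 2 * n) * Real.exp (-(Real.pi * s) * x ^ (2 : ℝ))) := by
  rw [besselWeight, gauss, Real.rpow_add hx (2 * α + 1), Real.rpow_two,
    show (2 : ℝ) * n = ((2 * n : ℕ) : ℝ) by push_cast; ring, Real.rpow_natCast]
  ring

theorem integrable_pow_mul_gauss {α s : ℝ} (hα : -1 / 2 < α) (hs : 0 < s) (n : ℕ) :
    Integrable (fun x => x ^ (2 * n) * gauss s x) (besselMeasure α) := by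
  have hn : (0 : ℝ) ≤ n := n.cast_nonneg
  rw [integrable_besselMeasure_iff]
  have := (integrableOn_rpow_mul_exp_neg_mul_rpow (p := 2) (s := 2 * α + 1 + 2 * n)
    (b := Real.pi * s) (by linarith) (by norm_num) (by positivity)).const_mul
      ((2 * Real.pi) ^ (α + 1))
  refine IntegrableOn.congr_fun this (fun x hx => ?_) measurableSet_Ioi
  rw [smul_eq_mul, weight_mul_pow_mul_gauss α s n hx]

theorem integral_pow_mul_gauss {α s : ℝ} (hα : -1 / 2 < α) (hs : 0 < s) (n : ℕ) :
    ∫ x, x ^ (2 * n) * gauss s x ∂(besselMeasure α) =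
      2 ^ α * s ^ (-(α + 1)) * (Real.pi * s)⁻¹ ^ n * Real.Gamma (n + α + 1) := by
  have hn : (0 : ℝ) ≤ n := n.cast_nonneg
  have hpi := Real.pi_pos
  rw [integral_besselMeasure]
  rw [setIntegral_congr_fun measurableSet_Ioi
    (g := fun x => (2 * Real.pi) ^ (α + 1) *
        (x ^ (2 * α + 1 + 2 * n) * Real.exp (-(Real.pi * s) * x ^ (2 : ℝ))))
    (fun x hx => by rw [smul_eq_mul, weight_mul_pow_mul_gauss α s n hx]),
    integral_const_mul, integral_rpow_mul_exp_neg_mul_rpow (by norm_num) (by linarith)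
      (by positivity), show (2 * α + 1 + 2 * n + 1) / 2 = n + α + 1 by ring,
    show -(2 * α + 1 + 2 * (n : ℝ) + 1) / 2 = -(α + 1) + -(n : ℝ) by ring,
    Real.rpow_add (show 0 < Real.pi * s by positivity) (-(α + 1)),
    Real.rpow_neg (by positivity) (n : ℝ), Real.rpow_natCast,
    Real.mul_rpow (by positivity) (by positivity), Real.mul_rpow (by positivity) (by positivity),
    Real.rpow_neg hpi.le, Real.rpow_add_one (by norm_num : (2 : ℝ) ≠ 0), inv_pow]
  have : Real.pi ^ (α + 1) ≠ 0 := by positivity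
  field_simp

theorem integrable_gauss {α s : ℝ} (hα : -1 / 2 < α) (hs : 0 < s) :
    Integrable (gauss s) (besselMeasure α) := by
  simpa using integrable_pow_mul_gauss hα hs 0

theorem integral_gauss {α s : ℝ} (hα : -1 / 2 < α) (hs : 0 < s) :
    ∫ x, gauss s x ∂(besselMeasure α) = 2 ^ α * Real.Gamma (α + 1) * s ^ (-(α + 1)) := by
  have := integral_pow_mul_gauss hα hs 0
  simp only [mul_zero, pow_zero, one_mul, mul_one, Nat.cast_zero, zero_add] at this
  rw [this]
  ring

/-- The Gaussian moment of `x^{2n}` contributes `Γ(n + α + 1)`, which cancels the same factor in the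
Bessel coefficient and leaves the exponential series of `-π y² / s`. -/
theorem integral_gauss_mul_besselj {α s : ℝ} (hα : -1 / 2 < α) (hs : 0 < s) (y : ℝ) :
    ∫ x, gauss s x * besselj α (2 * Real.pi * x * y) ∂(besselMeasure α) =
      s ^ (-(α + 1)) * gauss s⁻¹ y := by
  have hpi := Real.pi_pos
  set G : ℕ → ℝ → ℝ := fun n x =>
    ((1 / (2 : ℝ) ^ α) * besselCoeff α n * (Real.pi * y) ^ (2 * n)) * (x ^ (2 * n) * gauss s x)
    with hG
  have hGi : ∀ n, Integrable (G n) (besselMeasure α) := fun n =>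
    (integrable_pow_mul_gauss hα hs n).const_mul _
  have hcoef : ∀ n : ℕ, |besselCoeff α n| * Real.Gamma (n + α + 1) = 1 / n.factorial := by
    intro n
    have hn : (0 : ℝ) ≤ n := n.cast_nonneg
    have hp : 0 < Real.Gamma ((n : ℝ) + α + 1) := Real.Gamma_pos_of_pos (by linarith)
    have hf : (0 : ℝ) < n.factorial := by exact_mod_cast n.factorial_pos
    rw [besselCoeff, abs_div, abs_pow, abs_neg, abs_one, one_pow, abs_of_pos (mul_pos hf hp)]
    field_simp
  have hcoef' : ∀ n : ℕ, besselCoeff α n * Real.Gamma (n + α + 1) = (-1) ^ n / n.factorial := by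
    intro n
    have hn : (0 : ℝ) ≤ n := n.cast_nonneg
    have hp : 0 < Real.Gamma ((n : ℝ) + α + 1) := Real.Gamma_pos_of_pos (by linarith)
    rw [besselCoeff]
    field_simp
  have hpow : ∀ n : ℕ, (Real.pi * y) ^ (2 * n) * (Real.pi * s)⁻¹ ^ n
      = (Real.pi * y ^ 2 / s) ^ n := by
    intro n
    rw [pow_mul, ← mul_pow]
    congr 1
    field_simp
  have hGint : ∀ n, ∫ x, G n x ∂(besselMeasure α) =
      s ^ (-(α + 1)) * ((-(Real.pi * y ^ 2 / s)) ^ n / n.factorial) := by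
    intro n
    simp only [hG]
    rw [integral_const_mul, integral_pow_mul_gauss hα hs n]
    calc _ = ((1 / (2 : ℝ) ^ α) * 2 ^ α) * s ^ (-(α + 1)) *
          ((Real.pi * y) ^ (2 * n) * (Real.pi * s)⁻¹ ^ n) *
          (besselCoeff α n * Real.Gamma (n + α + 1)) := by ring
      _ = _ := by
        rw [hpow, hcoef', one_div_mul_cancel (by positivity), neg_pow (Real.pi * y ^ 2 / s)]
        ring
  have hGnorm : ∀ n, ∫ x, ‖G n x‖ ∂(besselMeasure α) =
      s ^ (-(α + 1)) * ((Real.pi * y ^ 2 / s) ^ n / n.factorial) := by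
    intro n
    have : ∀ x, ‖G n x‖ = ((1 / (2 : ℝ) ^ α) * |besselCoeff α n| * (Real.pi * y) ^ (2 * n)) *
        (x ^ (2 * n) * gauss s x) := by
      intro x
      have h1 : 0 ≤ (Real.pi * y) ^ (2 * n) := by rw [pow_mul]; positivity
      have h2 : 0 ≤ x ^ (2 * n) := by rw [pow_mul]; positivity
      simp only [hG]
      rw [Real.norm_eq_abs, abs_mul, abs_mul, abs_mul, abs_of_nonneg h1,
        abs_of_nonneg (mul_nonneg h2 (gauss_pos s x).le),
        abs_of_pos (show 0 < 1 / (2 : ℝ) ^ α by positivity)]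
    simp only [this]
    rw [integral_const_mul, integral_pow_mul_gauss hα hs n]
    calc _ = ((1 / (2 : ℝ) ^ α) * 2 ^ α) * s ^ (-(α + 1)) *
          ((Real.pi * y) ^ (2 * n) * (Real.pi * s)⁻¹ ^ n) *
          (|besselCoeff α n| * Real.Gamma (n + α + 1)) := by ring
      _ = _ := by
        rw [hpow, hcoef, one_div_mul_cancel (by positivity)]
        ring
  have hsum := hasSum_integral_of_summable_integral_norm hGi (by
    simp only [hGnorm]
    exact (Real.summable_pow_div_factorial _).mul_left _)
  have hfun : ∀ x, ∑' n, G n x = gauss s x * besselj α (2 * Real.pi * x * y) := by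
    intro x
    rw [besselj_eq_besselSeries, besselSeries, ← mul_assoc, ← tsum_mul_left]
    refine tsum_congr fun n => ?_
    simp only [hG]
    rw [show 2 * Real.pi * x * y / 2 = (Real.pi * y) * x by ring, ← pow_mul, mul_pow]
    ring
  simp only [hfun, hGint] at hsum
  have hexp : HasSum (fun n : ℕ => s ^ (-(α + 1)) * ((-(Real.pi * y ^ 2 / s)) ^ n / n.factorial))
      (s ^ (-(α + 1)) * gauss s⁻¹ y) := by
    refine HasSum.mul_left _ ?_
    have h := NormedSpace.expSeries_div_hasSum_exp (-(Real.pi * y ^ 2 / s))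
    rw [← Real.exp_eq_exp_ℝ] at h
    have hg : gauss s⁻¹ y = Real.exp (-(Real.pi * y ^ 2 / s)) := by
      rw [gauss]
      congr 1
      ring
    rw [hg]
    exact h
  exact hsum.unique hexp

theorem fourierBessel_gauss {α s : ℝ} (hα : -1 / 2 < α) (hs : 0 < s) (y : ℝ) :
    fourierBessel α (fun x => (gauss s x : ℂ)) y =
      ((s ^ (-(α + 1)) * gauss s⁻¹ y : ℝ) : ℂ) := by
  rw [← integral_gauss_mul_besselj hα hs y, ← integral_complex_ofReal]
  simp only [fourierBessel, Complex.ofReal_mul]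

/-! ### Uniqueness for the Laplace transform in the variable `x²` -/

theorem gauss_natCast (n : ℕ) (x : ℝ) : gauss n x = gauss 1 x ^ n := by
  rw [gauss, gauss, ← Real.exp_nat_mul]
  congr 1
  ring

/-- Two finite measures on `ℝ≥0` whose integrals against all `exp (-π n x²)`, `n ∈ ℕ`, agree
are equal. -/
theorem measure_nnreal_ext_of_integral_gauss {P Q : Measure NNReal} [IsFiniteMeasure P]
    [IsFiniteMeasure Q]
    (h : ∀ n : ℕ, ∫ x : NNReal, gauss n x ∂P = ∫ x : NNReal, gauss n x ∂Q) : P = Q := by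
  -- Powers of `φ` are the Gaussians with natural parameter, so the hypothesis covers the whole
  -- algebra of polynomials in `φ`. On the half-line `φ` is injective, hence this algebra separates
  -- points; on `ℝ` evenness would prevent that.
  let φ : BoundedContinuousFunction NNReal ℝ := BoundedContinuousFunction.ofNormedAddCommGroup
    (fun x : NNReal => gauss 1 x) ((continuous_gauss 1).comp NNReal.continuous_coe) 1 (fun x => by
      rw [Real.norm_eq_abs, abs_of_pos (gauss_pos _ _), gauss, Real.exp_le_one_iff]
      have := Real.pi_pos
      nlinarith [sq_nonneg (x : ℝ)])
  have hφ : ∀ x : NNReal, φ x = gauss 1 x := fun x => rfl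
  let A : StarSubalgebra ℝ (BoundedContinuousFunction NNReal ℝ) :=
    { (Polynomial.aeval φ).range with
      star_mem' := by
        intro a ha
        have : star a = a := by
          ext x
          simp
        rw [this]
        exact ha }
  refine ext_of_forall_mem_subalgebra_integral_eq_of_polish (𝕜 := ℝ) (A := A) ?_ ?_
  · intro x y hxy
    refine ⟨φ, ⟨BoundedContinuousFunction.toContinuousMapStarₐ ℝ φ,
      ⟨φ, ⟨Polynomial.X, by simp⟩, rfl⟩, rfl⟩, fun he => hxy ?_⟩
    rw [hφ, hφ, gauss, gauss, Real.exp_eq_exp] at he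
    have hpi := Real.pi_pos
    have h2 : (x : ℝ) ^ 2 = (y : ℝ) ^ 2 := by
      have : Real.pi * ((x : ℝ) ^ 2 - (y : ℝ) ^ 2) = 0 := by linarith
      rcases mul_eq_zero.1 this with h | h
      · exact absurd h hpi.ne'
      · linarith
    exact NNReal.coe_injective ((sq_eq_sq₀ x.2 y.2).1 h2)
  · rintro g ⟨p, rfl⟩
    change ∫ x, (Polynomial.aeval φ p) x ∂P = ∫ x, (Polynomial.aeval φ p) x ∂Q
    induction p using Polynomial.induction_on' with
    | add p q hp hq =>
      simp only [map_add, BoundedContinuousFunction.add_apply]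
      rw [integral_add (BoundedContinuousFunction.integrable _ _)
        (BoundedContinuousFunction.integrable _ _), hp, hq,
        integral_add (BoundedContinuousFunction.integrable _ _)
        (BoundedContinuousFunction.integrable _ _)]
    | monomial n a =>
      have : ∀ x, (Polynomial.aeval φ (Polynomial.monomial n a)) x = a * gauss n x := by
        intro x
        rw [Polynomial.aeval_monomial, gauss_natCast, ← hφ]
        simp
      simp only [this, integral_const_mul, h]

/-- One Gaussian factor is spent on making `q = h * gauss 1` integrable. The positive and negative
parts of `q` are then densities of finite measures with the same Gaussian integrals. -/
theorem ae_eq_zero_of_integral_mul_gauss {α : ℝ} {h : ℝ → ℝ}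
    (hi : ∀ n : ℕ, Integrable (fun x => h x * gauss (n + 1) x) (besselMeasure α))
    (h0 : ∀ n : ℕ, ∫ x, h x * gauss (n + 1) x ∂(besselMeasure α) = 0) :
    ∀ᵐ x ∂(besselMeasure α), h x = 0 := by
  set μ := besselMeasure α with hμ
  set q : ℝ → ℝ := fun x => h x * gauss 1 x with hq
  have hqi : Integrable q μ := by simpa using hi 0
  have hqg : ∀ (n : ℕ) (x : ℝ), h x * gauss (n + 1) x = q x * gauss n x := by
    intro n x
    rw [hq, mul_assoc, gauss_mul_gauss, add_comm (1 : ℝ)]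
  simp only [hqg] at hi h0
  have hg1 : ∀ (n : ℕ) (x : ℝ), |gauss n x| ≤ 1 := by
    intro n x
    rw [abs_of_pos (gauss_pos _ _), gauss, Real.exp_le_one_iff]
    have := mul_nonneg (mul_nonneg Real.pi_pos.le (n.cast_nonneg : (0 : ℝ) ≤ n)) (sq_nonneg x)
    linarith
  have hfin : ∀ {r : ℝ → ℝ}, Integrable r μ →
      IsFiniteMeasure (μ.withDensity fun x => ENNReal.ofReal (r x)) :=
    fun hr => isFiniteMeasure_withDensity_ofReal hr.2
  have := hfin hqi
  have := hfin hqi.neg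
  have hmapInt : ∀ {r : ℝ → ℝ}, Integrable r μ → ∀ n : ℕ,
      ∫ x : NNReal, gauss n x ∂((μ.withDensity fun x => ENNReal.ofReal (r x)).map Real.toNNReal)
        = ∫ x, max (r x) 0 * gauss n x ∂μ := by
    intro r hr n
    have hc : Continuous fun x : NNReal => gauss n x :=
      (continuous_gauss n).comp NNReal.continuous_coe
    rw [integral_map measurable_real_toNNReal.aemeasurable hc.aestronglyMeasurable,
      integral_withDensity_eq_integral_toReal_smul₀ hr.aemeasurable.ennreal_ofReal (by simp)]
    refine integral_congr_ae ?_
    filter_upwards [ae_besselMeasure_pos α] with x hx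
    rw [Real.coe_toNNReal x hx.le, ENNReal.toReal_ofReal', smul_eq_mul]
  have hmap : (μ.withDensity fun x => ENNReal.ofReal (q x)).map Real.toNNReal =
      (μ.withDensity fun x => ENNReal.ofReal ((-q) x)).map Real.toNNReal := by
    refine measure_nnreal_ext_of_integral_gauss fun n => ?_
    have hbd : ∀ {r : ℝ → ℝ}, Integrable r μ →
        Integrable (fun x => max (r x) 0 * gauss n x) μ := fun hr =>
      hr.pos_part.mul_bdd (c := 1) (continuous_gauss n).aestronglyMeasurable
        (Filter.Eventually.of_forall (hg1 n))
    rw [hmapInt hqi, hmapInt hqi.neg, ← sub_eq_zero, ← integral_sub (hbd hqi) (hbd hqi.neg)]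
    refine Eq.trans ?_ (h0 n)
    refine integral_congr_ae (Filter.Eventually.of_forall fun x => ?_)
    simp only [Pi.neg_apply]
    rcases le_total (q x) 0 with hx | hx
    · rw [max_eq_right hx, max_eq_left (by linarith)]
      ring
    · rw [max_eq_left hx, max_eq_right (by linarith)]
      ring
  -- Passing to `ℝ≥0` loses nothing, because `μ` is carried by the positive reals.
  have hback : ∀ {r : ℝ → ℝ}, (((μ.withDensity fun x => ENNReal.ofReal (r x)).map
      Real.toNNReal).map ((↑) : NNReal → ℝ)) = μ.withDensity fun x => ENNReal.ofReal (r x) := by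
    intro r
    rw [Measure.map_map (by fun_prop) (by fun_prop)]
    have : ((↑) : NNReal → ℝ) ∘ Real.toNNReal =ᵐ[μ.withDensity fun x => ENNReal.ofReal (r x)]
        id := by
      refine (withDensity_absolutelyContinuous μ _).ae_le ?_
      filter_upwards [ae_besselMeasure_pos α] with x hx
      exact Real.coe_toNNReal x hx.le
    rw [Measure.map_congr this, Measure.map_id]
  have heq : (μ.withDensity fun x => ENNReal.ofReal (q x)) =
      μ.withDensity fun x => ENNReal.ofReal ((-q) x) := by
    rw [← hback (r := q), ← hback (r := -q), hmap]
  rw [withDensity_eq_iff_of_sigmaFinite hqi.aemeasurable.ennreal_ofReal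
    hqi.neg.aemeasurable.ennreal_ofReal] at heq
  filter_upwards [heq] with x hx
  have hq0 : q x = 0 := by
    have := congrArg ENNReal.toReal hx
    rw [ENNReal.toReal_ofReal', ENNReal.toReal_ofReal', Pi.neg_apply] at this
    rcases le_total (q x) 0 with h' | h'
    · rw [max_eq_right h', max_eq_left (by linarith)] at this
      linarith
    · rw [max_eq_left h', max_eq_right (by linarith)] at this
      linarith
  exact (mul_eq_zero.1 hq0).resolve_right (gauss_pos 1 x).ne'

theorem ae_eq_zero_of_integral_mul_gauss_complex {α : ℝ} {h : ℝ → ℂ}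
    (hi : ∀ s : ℝ, 0 < s → Integrable (fun x => h x * (gauss s x : ℂ)) (besselMeasure α))
    (h0 : ∀ s : ℝ, 0 < s → ∫ x, h x * (gauss s x : ℂ) ∂(besselMeasure α) = 0) :
    ∀ᵐ x ∂(besselMeasure α), h x = 0 := by
  have hn : ∀ n : ℕ, (0 : ℝ) < n + 1 := fun n => by positivity
  have hre : ∀ᵐ x ∂(besselMeasure α), (h x).re = 0 := by
    refine ae_eq_zero_of_integral_mul_gauss (fun n => ?_) (fun n => ?_)
    · simpa using (hi _ (hn n)).re
    · have := integral_re (hi _ (hn n))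
      rw [h0 _ (hn n)] at this
      simpa using this
  have him : ∀ᵐ x ∂(besselMeasure α), (h x).im = 0 := by
    refine ae_eq_zero_of_integral_mul_gauss (fun n => ?_) (fun n => ?_)
    · simpa using (hi _ (hn n)).im
    · have := integral_im (hi _ (hn n))
      rw [h0 _ (hn n)] at this
      simpa using this
  filter_upwards [hre, him] with x h1 h2
  exact Complex.ext h1 h2

/-! ### The Fourier–Bessel transform on `L²_α` -/

theorem memLp_gauss {α s : ℝ} (hα : -1 / 2 < α) (hs : 0 < s) :
    MemLp (fun x => (gauss s x : ℂ)) 2 (besselMeasure α) := by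
  have hc : Continuous fun x => (gauss s x : ℂ) :=
    Complex.continuous_ofReal.comp (continuous_gauss s)
  rw [memLp_two_iff_integrable_sq_norm hc.aestronglyMeasurable]
  refine (integrable_gauss hα (add_pos hs hs)).congr (Filter.Eventually.of_forall fun x => ?_)
  simp only [Complex.norm_real, Real.norm_eq_abs, sq_abs]
  rw [← gauss_mul_gauss, sq]

/-- The Gaussians as elements of `L²_α`. -/
noncomputable def gaussLp {α : ℝ} (hα : -1 / 2 < α) (s : Set.Ioi (0 : ℝ)) : L2Bessel α :=
  (memLp_gauss hα s.2).toLp _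

theorem inner_gaussLp {α : ℝ} (hα : -1 / 2 < α) (s : Set.Ioi (0 : ℝ)) (f : L2Bessel α) :
    inner ℂ (gaussLp hα s) f = ∫ x, f x * (gauss s x : ℂ) ∂(besselMeasure α) := by
  rw [L2.inner_def]
  refine integral_congr_ae ?_
  filter_upwards [(memLp_gauss hα s.2).coeFn_toLp] with x hx
  rw [gaussLp, hx, RCLike.inner_apply, Complex.conj_ofReal]

theorem integrable_mul_gauss {α : ℝ} (hα : -1 / 2 < α) {s : ℝ} (hs : 0 < s) (f : L2Bessel α) :
    Integrable (fun x => f x * (gauss s x : ℂ)) (besselMeasure α) :=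
  (Lp.memLp f).integrable_mul (memLp_gauss hα hs)

theorem inner_gaussLp_gaussLp {α : ℝ} (hα : -1 / 2 < α) (s t : Set.Ioi (0 : ℝ)) :
    inner ℂ (gaussLp hα s) (gaussLp hα t) =
      ((2 ^ α * Real.Gamma (α + 1) * ((s : ℝ) + t) ^ (-(α + 1)) : ℝ) : ℂ) := by
  rw [inner_gaussLp, ← integral_gauss hα (add_pos s.2 t.2), ← integral_complex_ofReal]
  refine integral_congr_ae ?_
  filter_upwards [(memLp_gauss hα t.2).coeFn_toLp] with x hx
  rw [gaussLp, hx, ← Complex.ofReal_mul, gauss_mul_gauss, add_comm (s : ℝ)]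

/-- The reciprocal of a positive real. -/
noncomputable def posInv (s : Set.Ioi (0 : ℝ)) : Set.Ioi (0 : ℝ) :=
  ⟨(s : ℝ)⁻¹, Set.mem_Ioi.2 (inv_pos.2 (Set.mem_Ioi.1 s.2))⟩

/-- The Fourier–Bessel transforms of the Gaussians. -/
noncomputable def gaussLpTransform {α : ℝ} (hα : -1 / 2 < α) (s : Set.Ioi (0 : ℝ)) :
    L2Bessel α :=
  (((s : ℝ) ^ (-(α + 1)) : ℝ) : ℂ) • gaussLp hα (posInv s)

/-- Rests on `s + t = s t (1/s + 1/t)`; this is Plancherel's identity on Gaussians. -/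
theorem inner_gaussLpTransform_gaussLpTransform {α : ℝ} (hα : -1 / 2 < α)
    (s t : Set.Ioi (0 : ℝ)) :
    inner ℂ (gaussLpTransform hα s) (gaussLpTransform hα t) =
      inner ℂ (gaussLp hα s) (gaussLp hα t) := by
  have hs : (0 : ℝ) < s := s.2
  have ht : (0 : ℝ) < t := t.2
  rw [gaussLpTransform, gaussLpTransform, inner_smul_left, inner_smul_right,
    inner_gaussLp_gaussLp, inner_gaussLp_gaussLp, Complex.conj_ofReal, ← Complex.ofReal_mul,
    ← Complex.ofReal_mul]
  congr 1
  have : (s : ℝ) + t = s * (t * ((s : ℝ)⁻¹ + (t : ℝ)⁻¹)) := by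
    field_simp
    ring
  rw [this, Real.mul_rpow hs.le (by positivity), Real.mul_rpow ht.le (by positivity)]
  simp only [posInv]
  ring

/-- Both sides depend only on `s t + 1`. This is the symmetry of the transform on Gaussians. -/
theorem inner_gaussLp_gaussLpTransform {α : ℝ} (hα : -1 / 2 < α) (s t : Set.Ioi (0 : ℝ)) :
    inner ℂ (gaussLp hα s) (gaussLpTransform hα t) =
      inner ℂ (gaussLpTransform hα s) (gaussLp hα t) := by
  have hs : (0 : ℝ) < s := s.2
  have ht : (0 : ℝ) < t := t.2
  rw [gaussLpTransform, gaussLpTransform, inner_smul_left, inner_smul_right,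
    inner_gaussLp_gaussLp, inner_gaussLp_gaussLp, Complex.conj_ofReal, ← Complex.ofReal_mul,
    ← Complex.ofReal_mul]
  congr 1
  have : (t : ℝ) * (s + (t : ℝ)⁻¹) = s * ((s : ℝ)⁻¹ + t) := by
    field_simp
    ring
  have h2 : (t : ℝ) ^ (-(α + 1)) * ((s : ℝ) + (t : ℝ)⁻¹) ^ (-(α + 1)) =
      (s : ℝ) ^ (-(α + 1)) * ((s : ℝ)⁻¹ + t) ^ (-(α + 1)) := by
    rw [← Real.mul_rpow ht.le (by positivity), ← Real.mul_rpow hs.le (by positivity), this]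
  simp only [posInv]
  linear_combination (2 ^ α * Real.Gamma (α + 1)) * h2

/-- Two families with the same Gram matrix have linear combinations of the same norm. -/
theorem norm_linearCombination_eq_of_inner_eq {ι E : Type*} [NormedAddCommGroup E]
    [InnerProductSpace ℂ E] {a b : ι → E}
    (h : ∀ i j, inner ℂ (b i) (b j) = inner ℂ (a i) (a j)) (c : ι →₀ ℂ) :
    ‖Finsupp.linearCombination ℂ b c‖ = ‖Finsupp.linearCombination ℂ a c‖ := by
  have : inner ℂ (Finsupp.linearCombination ℂ b c) (Finsupp.linearCombination ℂ b c) =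
      inner ℂ (Finsupp.linearCombination ℂ a c) (Finsupp.linearCombination ℂ a c) := by
    simp only [Finsupp.linearCombination_apply, Finsupp.sum, sum_inner, inner_sum,
      inner_smul_left, inner_smul_right, h]
  rw [@norm_eq_sqrt_re_inner ℂ, @norm_eq_sqrt_re_inner ℂ, this]

theorem denseRange_linearCombination_gaussLp {α : ℝ} (hα : -1 / 2 < α) :
    DenseRange (Finsupp.linearCombination ℂ (gaussLp hα)) := by
  have h : (LinearMap.range (Finsupp.linearCombination ℂ (gaussLp hα))).topologicalClosure
      = ⊤ := by
    rw [Submodule.topologicalClosure_eq_top_iff, Submodule.eq_bot_iff]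
    intro v hv
    have hz : ∀ᵐ x ∂(besselMeasure α), v x = 0 := by
      refine ae_eq_zero_of_integral_mul_gauss_complex
        (fun s hs => integrable_mul_gauss hα hs v) (fun s hs => ?_)
      have := (Submodule.mem_orthogonal _ v).1 hv (gaussLp hα ⟨s, hs⟩)
        ⟨Finsupp.single ⟨s, hs⟩ 1, by simp⟩
      rwa [inner_gaussLp] at this
    refine Lp.ext ?_
    filter_upwards [hz, Lp.coeFn_zero ℂ 2 (besselMeasure α)] with x h1 h2
    rw [h1, h2]
    rfl
  have := congrArg (fun K : Submodule ℂ (L2Bessel α) => (K : Set (L2Bessel α))) h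
  simp only [Submodule.topologicalClosure_coe, Submodule.top_coe] at this
  rw [DenseRange, dense_iff_closure_eq, ← this]
  rfl

/-- The isometry of `L²_α` that maps each Gaussian to its Fourier–Bessel transform. -/
theorem exists_isometry_gaussLp {α : ℝ} (hα : -1 / 2 < α) :
    ∃ F : L2Bessel α →ₗᵢ[ℂ] L2Bessel α, ∀ s, F (gaussLp hα s) = gaussLpTransform hα s := by
  have hd := denseRange_linearCombination_gaussLp hα
  have hn := norm_linearCombination_eq_of_inner_eq (inner_gaussLpTransform_gaussLpTransform hα)
  set e := Finsupp.linearCombination ℂ (gaussLp hα)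
  set e' := Finsupp.linearCombination ℂ (gaussLpTransform hα)
  -- Equality of norms makes `e c ↦ e' c` well defined and bounded on a dense subspace.
  have heq : ∀ c, e'.extendOfNorm e (e c) = e' c :=
    LinearMap.extendOfNorm_eq hd ⟨1, fun c => by rw [one_mul, hn]⟩
  refine ⟨⟨(e'.extendOfNorm e).toLinearMap, fun f => ?_⟩, fun s => ?_⟩
  · refine hd.induction (P := fun f => ‖e'.extendOfNorm e f‖ = ‖f‖) ?_ ?_ f
    · rintro _ ⟨c, rfl⟩
      rw [heq, hn]
    · exact isClosed_eq (by fun_prop) (by fun_prop)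
  · have := heq (Finsupp.single s 1)
    simpa [e, e'] using this

theorem integrable_fourierBessel_kernel {α : ℝ} (hα : -1 / 2 < α) {f : ℝ → ℂ}
    (hf : Integrable f (besselMeasure α)) {t : ℝ} (ht : 0 < t) :
    Integrable (fun p : ℝ × ℝ =>
      f p.1 * (gauss t p.2 : ℂ) * (besselj α (2 * Real.pi * p.1 * p.2) : ℂ))
      ((besselMeasure α).prod (besselMeasure α)) := by
  obtain ⟨C, -, hC, -⟩ := besselj_bounds hα
  have hj : Continuous fun p : ℝ × ℝ => (besselj α (2 * Real.pi * p.1 * p.2) : ℂ) := by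
    have := continuous_besselj (α := α) (by linarith)
    fun_prop
  refine (hf.mul_prod (integrable_gauss hα ht).ofReal).mul_bdd (c := C)
    hj.aestronglyMeasurable (Filter.Eventually.of_forall fun p => ?_)
  rw [Complex.norm_real]
  exact hC _

theorem integrable_fourierBessel_mul_gauss {α : ℝ} (hα : -1 / 2 < α) {f : ℝ → ℂ}
    (hf : Integrable f (besselMeasure α)) {t : ℝ} (ht : 0 < t) :
    Integrable (fun y => fourierBessel α f y * (gauss t y : ℂ)) (besselMeasure α) := by
  refine (integrable_fourierBessel_kernel hα hf ht).integral_prod_right.congr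
    (Filter.Eventually.of_forall fun y => ?_)
  simp only [fourierBessel]
  rw [← integral_mul_const]
  refine integral_congr_ae (Filter.Eventually.of_forall fun x => ?_)
  simp only
  ring

/-- The kernel is symmetric in `x` and `y`, so Fubini moves the transform onto the Gaussian. -/
theorem integral_fourierBessel_mul_gauss {α : ℝ} (hα : -1 / 2 < α) {f : ℝ → ℂ}
    (hf : Integrable f (besselMeasure α)) {t : ℝ} (ht : 0 < t) :
    ∫ y, fourierBessel α f y * (gauss t y : ℂ) ∂(besselMeasure α) =
      ((t ^ (-(α + 1)) : ℝ) : ℂ) * ∫ x, f x * (gauss t⁻¹ x : ℂ) ∂(besselMeasure α) := by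
  have hswap := integral_integral_swap (f := fun x y => f x * (gauss t y : ℂ) *
    (besselj α (2 * Real.pi * x * y) : ℂ)) (integrable_fourierBessel_kernel hα hf ht)
  calc ∫ y, fourierBessel α f y * (gauss t y : ℂ) ∂(besselMeasure α)
      = ∫ y, ∫ x, f x * (gauss t y : ℂ) * (besselj α (2 * Real.pi * x * y) : ℂ)
          ∂(besselMeasure α) ∂(besselMeasure α) := by
        refine integral_congr_ae (Filter.Eventually.of_forall fun y => ?_)
        simp only [fourierBessel]
        rw [← integral_mul_const]
        refine integral_congr_ae (Filter.Eventually.of_forall fun x => ?_)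
        simp only
        ring
    _ = ∫ x, ((t ^ (-(α + 1)) : ℝ) : ℂ) * (f x * (gauss t⁻¹ x : ℂ)) ∂(besselMeasure α) := by
        rw [← hswap]
        refine integral_congr_ae (Filter.Eventually.of_forall fun x => ?_)
        have h := fourierBessel_gauss hα ht x
        simp only [fourierBessel] at h
        simp only [mul_assoc (f x)]
        rw [integral_const_mul]
        have h' : ∫ y, (gauss t y : ℂ) * (besselj α (2 * Real.pi * x * y) : ℂ)
            ∂(besselMeasure α) = ((t ^ (-(α + 1)) * gauss t⁻¹ x : ℝ) : ℂ) := by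
          rw [← h]
          refine integral_congr_ae (Filter.Eventually.of_forall fun y => ?_)
          simp only
          rw [show 2 * Real.pi * x * y = 2 * Real.pi * y * x by ring]
        rw [h']
        push_cast
        ring
    _ = _ := integral_const_mul _ _

/-- **Plancherel theorem** for the Fourier–Bessel transform. -/
theorem exists_isFourierBesselL2 {α : ℝ} (hα : -1 / 2 < α) :
    ∃ F : L2Bessel α →ₗᵢ[ℂ] L2Bessel α, IsFourierBesselL2 α F := by
  obtain ⟨F, hF⟩ := exists_isometry_gaussLp hα
  refine ⟨F, fun f hf => ?_⟩
  -- The abstract `F` satisfies the same duality with Gaussians as the integral transform does, so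
  -- Gaussians cannot distinguish `F f` from `fourierBessel α f`.
  have hsym : ∀ (t : Set.Ioi (0 : ℝ)) (g : L2Bessel α),
      inner ℂ (gaussLp hα t) (F g) = inner ℂ (gaussLpTransform hα t) g := by
    intro t g
    refine (denseRange_linearCombination_gaussLp hα).induction
      (P := fun g => inner ℂ (gaussLp hα t) (F g) = inner ℂ (gaussLpTransform hα t) g) ?_ ?_ g
    · rintro _ ⟨c, rfl⟩
      simp only [Finsupp.linearCombination_apply, Finsupp.sum, map_sum, map_smul, inner_sum,
        inner_smul_right, hF, inner_gaussLp_gaussLpTransform]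
    · exact isClosed_eq (by fun_prop) (by fun_prop)
  have hz : ∀ᵐ y ∂(besselMeasure α), F f y - fourierBessel α f y = 0 := by
    refine ae_eq_zero_of_integral_mul_gauss_complex (fun t ht => ?_) (fun t ht => ?_)
    · refine ((integrable_mul_gauss hα ht (F f)).sub
        (integrable_fourierBessel_mul_gauss hα hf ht)).congr
        (Filter.Eventually.of_forall fun y => ?_)
      simp only [Pi.sub_apply]
      ring
    · simp only [sub_mul]
      rw [integral_sub (integrable_mul_gauss hα ht (F f))
        (integrable_fourierBessel_mul_gauss hα hf ht), integral_fourierBessel_mul_gauss hα hf ht]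
      have h1 := hsym ⟨t, ht⟩ f
      rw [gaussLpTransform, inner_smul_left, Complex.conj_ofReal, inner_gaussLp, inner_gaussLp]
        at h1
      rw [h1, sub_eq_zero]
      rfl
  filter_upwards [hz] with y hy
  exact sub_eq_zero.1 hy

/-! ### The kernel on sets of finite Lebesgue measure -/

/-- The squared decay of `j_α` exactly cancels the weight in `x`, which is why Lebesgue measure, and
not `μ_α`, governs the kernel. -/
theorem exists_weight_mul_besselj_sq_le {α : ℝ} (hα : -1 / 2 < α) :
    ∃ A : ℝ, 0 ≤ A ∧ ∀ x y : ℝ, 0 < x → 0 < y →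
      besselWeight α x * besselj α (2 * Real.pi * x * y) ^ 2 ≤ A * y ^ (-(2 * α + 1)) := by
  obtain ⟨C, hC0, -, hC⟩ := besselj_bounds hα
  have hpi := Real.pi_pos
  refine ⟨(2 * Real.pi) ^ (α + 1) * C ^ 2 * (2 * Real.pi) ^ (-(2 * α + 1)), by positivity,
    fun x y hx hy => ?_⟩
  have h1 := hC (2 * Real.pi * x * y) (by positivity)
  have h2 : besselj α (2 * Real.pi * x * y) ^ 2 ≤
      C ^ 2 * (2 * Real.pi * x * y) ^ (-(2 * α + 1)) := by
    rw [← sq_abs]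
    calc |besselj α (2 * Real.pi * x * y)| ^ 2
        ≤ (C * (2 * Real.pi * x * y) ^ (-(α + 1 / 2))) ^ 2 :=
          pow_le_pow_left₀ (abs_nonneg _) h1 2
      _ = C ^ 2 * (2 * Real.pi * x * y) ^ (-(2 * α + 1)) := by
          rw [mul_pow, ← Real.rpow_natCast (_ ^ (-(α + 1 / 2))), ← Real.rpow_mul (by positivity)]
          congr 2
          push_cast
          ring
  have h3 : x ^ (2 * α + 1) * x ^ (-(2 * α + 1)) = 1 := by
    rw [← Real.rpow_add hx, add_neg_cancel, Real.rpow_zero]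
  calc besselWeight α x * besselj α (2 * Real.pi * x * y) ^ 2
      ≤ besselWeight α x * (C ^ 2 * (2 * Real.pi * x * y) ^ (-(2 * α + 1))) :=
        mul_le_mul_of_nonneg_left h2 (besselWeight_pos α hx).le
    _ = (2 * Real.pi) ^ (α + 1) * C ^ 2 * (2 * Real.pi) ^ (-(2 * α + 1)) *
          y ^ (-(2 * α + 1)) * (x ^ (2 * α + 1) * x ^ (-(2 * α + 1))) := by
        rw [besselWeight, Real.mul_rpow (by positivity) hy.le, Real.mul_rpow (by positivity) hx.le]
        ring
    _ = _ := by rw [h3, mul_one]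

theorem norm_sq_eq_integral {α : ℝ} (f : L2Bessel α) :
    ‖f‖ ^ 2 = ∫ x, ‖f x‖ ^ 2 ∂(besselMeasure α) := by
  have h : (inner ℂ f f : ℂ) = ((∫ x, ‖f x‖ ^ 2 ∂(besselMeasure α) : ℝ) : ℂ) := by
    rw [L2.inner_def, ← integral_complex_ofReal]
    refine integral_congr_ae (Eventually.of_forall fun x => ?_)
    simp only [inner_self_eq_norm_sq_to_K]
    push_cast
    rfl
  rw [@norm_sq_eq_re_inner ℂ, h]
  exact Complex.ofReal_re _

/-- For `g ∈ L²_α` that vanishes outside a set `S` of finite Lebesgue measure, the integral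
defining the Fourier–Bessel transform at `y > 0` is the inner product with a kernel whose squared
norm is `O(y^{-(2α+1)} |S|)`. -/
theorem exists_kernel {α : ℝ} (hα : -1 / 2 < α) :
    ∃ A : ℝ, 0 ≤ A ∧ ∀ S : Set ℝ, MeasurableSet S → volume S < ⊤ → ∀ y : ℝ, 0 < y →
      ∃ k : L2Bessel α, ‖k‖ ^ 2 ≤ A * y ^ (-(2 * α + 1)) * volume.real S ∧
        ∀ g : ℝ → ℂ, (∀ᵐ x ∂(besselMeasure α), x ∉ S → g x = 0) →
          ∀ g' : L2Bessel α, g' =ᵐ[besselMeasure α] g →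
          fourierBessel α g y = inner ℂ k g' := by
  obtain ⟨A, hA0, hA⟩ := exists_weight_mul_besselj_sq_le hα
  refine ⟨A, hA0, fun S hS hSf y hy => ?_⟩
  have hjc : Continuous fun x => (besselj α (2 * Real.pi * x * y) : ℂ) := by
    have := continuous_besselj (α := α) (by linarith)
    fun_prop
  set κ : ℝ → ℂ := S.indicator fun x => (besselj α (2 * Real.pi * x * y) : ℂ) with hκ
  have hκm : Measurable κ := hjc.measurable.indicator hS
  have hle : ∀ x ∈ Set.Ioi (0 : ℝ), besselWeight α x • ‖κ x‖ ^ 2 ≤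
      S.indicator (fun _ => A * y ^ (-(2 * α + 1))) x := by
    intro x hx
    by_cases hxS : x ∈ S
    · simp only [hκ, Set.indicator_of_mem hxS, Complex.norm_real, Real.norm_eq_abs, sq_abs,
        smul_eq_mul]
      exact hA x y hx hy
    · simp [hκ, Set.indicator_of_notMem hxS]
  have hind : Integrable (S.indicator fun _ : ℝ => A * y ^ (-(2 * α + 1))) volume :=
    (integrable_indicator_iff hS).2 (integrableOn_const hSf.ne)
  have hκi : IntegrableOn (fun x => besselWeight α x • ‖κ x‖ ^ 2) (Set.Ioi 0) := by
    refine Integrable.mono' hind.integrableOn ?_ ?_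
    · exact ((measurable_besselWeight α).smul (hκm.norm.pow_const 2)).aestronglyMeasurable
    · filter_upwards [ae_restrict_mem measurableSet_Ioi] with x hx
      rw [Real.norm_eq_abs, abs_of_nonneg]
      · exact hle x hx
      · exact mul_nonneg (besselWeight_pos α hx).le (sq_nonneg _)
  have hmem : MemLp κ 2 (besselMeasure α) := by
    rw [memLp_two_iff_integrable_sq_norm hκm.aestronglyMeasurable, integrable_besselMeasure_iff]
    exact hκi
  refine ⟨hmem.toLp κ, ?_, fun g hg g' hg' => ?_⟩
  · rw [norm_sq_eq_integral]
    calc ∫ x, ‖hmem.toLp κ x‖ ^ 2 ∂(besselMeasure α) = ∫ x, ‖κ x‖ ^ 2 ∂(besselMeasure α) := by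
          refine integral_congr_ae ?_
          filter_upwards [hmem.coeFn_toLp] with x hx
          rw [hx]
      _ ≤ ∫ x in Set.Ioi (0 : ℝ), S.indicator (fun _ => A * y ^ (-(2 * α + 1))) x := by
          rw [integral_besselMeasure]
          exact setIntegral_mono_on hκi hind.integrableOn measurableSet_Ioi hle
      _ ≤ ∫ x, S.indicator (fun _ => A * y ^ (-(2 * α + 1))) x := by
          refine setIntegral_le_integral hind (Eventually.of_forall fun x => ?_)
          exact Set.indicator_nonneg (fun _ _ => by positivity) x
      _ = A * y ^ (-(2 * α + 1)) * volume.real S := by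
          rw [integral_indicator_const _ hS, smul_eq_mul, mul_comm]
  · rw [fourierBessel, L2.inner_def]
    refine integral_congr_ae ?_
    filter_upwards [hmem.coeFn_toLp, hg, hg'] with x h1 h2 h3
    rw [h1, RCLike.inner_apply, h3]
    by_cases hxS : x ∈ S
    · simp [hκ, Set.indicator_of_mem hxS]
    · simp [h2 hxS]

theorem exists_norm_fourierBessel_le {α : ℝ} (hα : -1 / 2 < α) {S : Set ℝ}
    (hS : MeasurableSet S) (hSf : volume S < ⊤) :
    ∃ B : ℝ, 0 ≤ B ∧ ∀ y : ℝ, 0 < y → ∀ g : L2Bessel α,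
      (∀ᵐ x ∂(besselMeasure α), x ∉ S → g x = 0) →
        ‖fourierBessel α g y‖ ≤ B * y ^ (-(α + 1 / 2)) * ‖g‖ := by
  obtain ⟨A, hA0, hA⟩ := exists_kernel hα
  refine ⟨Real.sqrt (A * volume.real S), Real.sqrt_nonneg _, fun y hy g hg => ?_⟩
  obtain ⟨k, hk, hkg⟩ := hA S hS hSf y hy
  rw [hkg g hg g (ae_eq_refl _)]
  refine (norm_inner_le_norm k g).trans (mul_le_mul_of_nonneg_right ?_ (norm_nonneg _))
  refine abs_le_of_sq_le_sq' ?_ (by positivity) |>.2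
  refine hk.trans (le_of_eq ?_)
  rw [mul_pow, Real.sq_sqrt (by positivity), ← Real.rpow_natCast (_ ^ (-(α + 1 / 2))),
    ← Real.rpow_mul hy.le, show -(α + 1 / 2) * ((2 : ℕ) : ℝ) = -(2 * α + 1) by push_cast; ring]
  ring

/-- Dominated convergence in `L²`. -/
theorem tendsto_eLpNorm_two_of_dominated {X : Type*} [MeasurableSpace X] {ν : Measure X}
    {f : ℕ → X → ℂ} {h : X → ℂ} {G : X → ℝ} (hf : ∀ n, AEStronglyMeasurable (f n) ν)
    (hh : AEStronglyMeasurable h ν) (hG : MemLp G 2 ν) (hb : ∀ n, ∀ᵐ x ∂ν, ‖f n x‖ ≤ G x)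
    (hlim : ∀ᵐ x ∂ν, Tendsto (fun n => f n x) atTop (𝓝 (h x))) :
    Tendsto (fun n => eLpNorm (f n - h) 2 ν) atTop (𝓝 0) := by
  have hG2 : MemLp (fun x => 2 * G x) 2 ν := hG.const_mul 2
  have hfin : ∫⁻ x, ‖2 * G x‖ₑ ^ (2 : ℝ) ∂ν ≠ ⊤ := by
    have := lintegral_rpow_enorm_lt_top_of_eLpNorm_lt_top (p := 2) (by simp) (by simp) hG2.2
    simpa using this.ne
  have hhb : ∀ᵐ x ∂ν, ‖h x‖ ≤ G x := by
    filter_upwards [ae_all_iff.2 hb, hlim] with x h1 h2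
    exact le_of_tendsto h2.norm (Eventually.of_forall h1)
  have key : Tendsto (fun n => ∫⁻ x, ‖(f n - h) x‖ₑ ^ (2 : ℝ) ∂ν) atTop (𝓝 0) := by
    have := tendsto_lintegral_of_dominated_convergence' (μ := ν)
      (F := fun n x => ‖(f n - h) x‖ₑ ^ (2 : ℝ)) (f := fun _ => 0)
      (fun x => ‖2 * G x‖ₑ ^ (2 : ℝ))
      (fun n => ((hf n).sub hh).enorm.pow_const _) (fun n => ?_) hfin ?_
    · simpa using this
    · filter_upwards [hb n, hhb] with x h1 h2
      refine ENNReal.rpow_le_rpow ?_ (by norm_num)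
      rw [enorm_le_iff_norm_le, Pi.sub_apply]
      calc ‖f n x - h x‖ ≤ ‖f n x‖ + ‖h x‖ := norm_sub_le _ _
        _ ≤ 2 * G x := by linarith
        _ ≤ ‖2 * G x‖ := le_abs_self _
    · filter_upwards [hlim] with x hx
      have h1 : Tendsto (fun n => ‖(f n - h) x‖ₑ) atTop (𝓝 0) := by
        have h2 : Tendsto (fun n => f n x - h x) atTop (𝓝 0) := by
          simpa using hx.sub_const (h x)
        simpa using h2.enorm
      have := h1.ennrpow_const 2
      simpa using this
  have := key.ennrpow_const (1 / 2)
  simp only [one_div, ENNReal.zero_rpow_of_pos (show (0 : ℝ) < 2⁻¹ by norm_num)] at this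
  refine this.congr fun n => ?_
  rw [eLpNorm_eq_lintegral_rpow_enorm_toReal (by simp) (by simp)]
  simp

/-- The Fourier–Bessel transform of `g ∈ L²_α` is given by the integral if `g` vanishes outside
a set of finite Lebesgue measure. -/
theorem IsFourierBesselL2.ae_eq_fourierBessel {α : ℝ} (hα : -1 / 2 < α)
    {F : L2Bessel α →ₗᵢ[ℂ] L2Bessel α} (hF : IsFourierBesselL2 α F) {S : Set ℝ}
    (hS : MeasurableSet S) (hSf : volume S < ⊤) {g : L2Bessel α}
    (hg : ∀ᵐ x ∂(besselMeasure α), x ∉ S → g x = 0) :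
    F g =ᵐ[besselMeasure α] fourierBessel α g := by
  -- Truncation to `x ≤ n` makes `g` integrable, since `μ_α` of that range is finite.
  have hmem : ∀ n : ℕ, MemLp ((Set.Iic (n : ℝ)).indicator g) 2 (besselMeasure α) :=
    fun n => (Lp.memLp g).indicator measurableSet_Iic
  set G : ℕ → L2Bessel α := fun n => (hmem n).toLp _ with hG
  have hGae : ∀ n, G n =ᵐ[besselMeasure α] (Set.Iic (n : ℝ)).indicator g :=
    fun n => (hmem n).coeFn_toLp
  have hfinite : ∀ n : ℕ, besselMeasure α (Set.Iic (n : ℝ)) < ⊤ := by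
    intro n
    rw [besselMeasure_eq_withDensity_Ioi, withDensity_apply _ measurableSet_Iic,
      Measure.restrict_restrict measurableSet_Iic, Set.inter_comm, Set.Ioi_inter_Iic]
    have hc : ContinuousOn (besselWeight α) (Set.Icc 0 (n : ℝ)) := by
      unfold besselWeight
      have : Continuous fun x : ℝ => x ^ (2 * α + 1) :=
        Real.continuous_rpow_const (by linarith)
      fun_prop
    have := (hc.integrableOn_Icc (μ := volume)).mono_set Set.Ioc_subset_Icc_self
    exact (lintegral_ofReal_le_lintegral_enorm _).trans_lt this.2
  have hGint : ∀ n, Integrable (G n) (besselMeasure α) := by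
    intro n
    rw [integrable_congr (hGae n), integrable_indicator_iff measurableSet_Iic]
    have : IsFiniteMeasure ((besselMeasure α).restrict (Set.Iic (n : ℝ))) :=
      ⟨by rw [Measure.restrict_apply_univ]; exact hfinite n⟩
    exact ((Lp.memLp g).restrict _).integrable (by norm_num)
  have hpt : ∀ x, Tendsto (fun n : ℕ => (Set.Iic (n : ℝ)).indicator g x) atTop (𝓝 (g x)) := by
    intro x
    obtain ⟨N, hN⟩ := exists_nat_ge x
    refine tendsto_const_nhds.congr' ?_
    filter_upwards [eventually_ge_atTop N] with n hn
    rw [Set.indicator_of_mem]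
    exact hN.trans (by exact_mod_cast hn)
  have hGlim : Tendsto G atTop (𝓝 g) := by
    rw [Lp.tendsto_Lp_iff_tendsto_eLpNorm']
    have := tendsto_eLpNorm_two_of_dominated (f := fun n => (Set.Iic (n : ℝ)).indicator g)
      (h := g) (fun n => (hmem n).1) (Lp.memLp g).1 (Lp.memLp g).norm
      (fun n => Eventually.of_forall fun x => norm_indicator_le_norm_self _ _)
      (Eventually.of_forall hpt)
    refine this.congr fun n => eLpNorm_congr_ae ?_
    filter_upwards [hGae n] with x hx
    simp only [Pi.sub_apply, hx]
  -- The transforms of the truncations converge to `F g` a.e. along a subsequence, and to the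
  -- integral at every `y > 0`, where they are inner products with a fixed kernel.
  obtain ⟨φ, hφ, hae⟩ := (tendstoInMeasure_of_tendsto_Lp
    ((F.continuous.tendsto g).comp hGlim)).exists_seq_tendsto_ae
  obtain ⟨A, -, hA⟩ := exists_kernel hα
  have hall : ∀ᵐ y ∂(besselMeasure α), ∀ n, F (G n) y = fourierBessel α (G n) y :=
    ae_all_iff.2 fun n => hF (G n) (hGint n)
  filter_upwards [hae, hall, ae_besselMeasure_pos α] with y h1 h2 hy
  obtain ⟨k, -, hk⟩ := hA S hS hSf y hy
  have h3 : Tendsto (fun n => F (G (φ n)) y) atTop (𝓝 (fourierBessel α g y)) := by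
    rw [hk g hg g (ae_eq_refl _)]
    have h4 : Tendsto (fun n => (inner ℂ k (G (φ n)) : ℂ)) atTop (𝓝 (inner ℂ k g)) :=
      (tendsto_const_nhds (x := k)).inner (hGlim.comp hφ.tendsto_atTop)
    refine h4.congr fun n => ?_
    rw [h2, hk (G (φ n)) ?_ _ (ae_eq_refl _)]
    filter_upwards [hg, hGae (φ n)] with x h5 h6 hxS
    rw [h6, Set.indicator_apply, h5 hxS, ite_self]
  exact tendsto_nhds_unique h1 h3

/-! ### Compactness -/

/-- A bounded sequence in a separable Hilbert space has a subsequence whose inner products with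
any fixed vector converge. -/
theorem exists_subseq_tendsto_inner {E : Type*} [NormedAddCommGroup E] [InnerProductSpace ℂ E]
    [TopologicalSpace.SeparableSpace E] {g : ℕ → E} {M : ℝ} (hg : ∀ n, ‖g n‖ ≤ M) :
    ∃ φ : ℕ → ℕ, StrictMono φ ∧ ∀ k : E, ∃ l : ℂ,
      Tendsto (fun n => (inner ℂ k (g (φ n)) : ℂ)) atTop (𝓝 l) := by
  obtain ⟨a, -, φ, hφ, hlim⟩ := WeakDual.isSeqCompact_closedBall ℂ E 0 M
    (x := fun n => StrongDual.toWeakDual (innerSL ℂ (g n))) (fun n => by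
      simpa using hg n)
  -- The functionals are `k ↦ ⟨g n, k⟩`, so their limit must be conjugated.
  refine ⟨φ, hφ, fun k => ⟨star (a k), ?_⟩⟩
  have h1 := ((WeakDual.eval_continuous k).tendsto a).comp hlim
  have h2 := (continuous_star.tendsto (a k)).comp h1
  refine h2.congr fun n => ?_
  exact inner_conj_symm k (g (φ n))

theorem separableSpace_L2Bessel (α : ℝ) : TopologicalSpace.SeparableSpace (L2Bessel α) := by
  have : Fact ((2 : ENNReal) ≠ ⊤) := ⟨by simp⟩
  infer_instance

/-- The weight cancels the squared power, leaving a constant on `T`. This supplies the dominating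
function for transforms of functions living on `S`. -/
theorem memLp_rpow_restrict {α : ℝ} {T : Set ℝ} (hT : MeasurableSet T) (hTf : volume T < ⊤)
    (B : ℝ) :
    MemLp (fun y => B * y ^ (-(α + 1 / 2))) 2 ((besselMeasure α).restrict T) := by
  refine MemLp.const_mul ?_ B
  have hm : Measurable fun y : ℝ => y ^ (-(α + 1 / 2)) := by fun_prop
  rw [memLp_two_iff_integrable_sq_norm hm.aestronglyMeasurable, ← IntegrableOn,
    ← integrable_indicator_iff hT, integrable_besselMeasure_iff]
  have hind : Integrable (T.indicator fun _ : ℝ => (2 * Real.pi) ^ (α + 1)) volume :=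
    (integrable_indicator_iff hT).2 (integrableOn_const hTf.ne)
  refine hind.integrableOn.congr_fun (fun y hy => ?_) measurableSet_Ioi
  have hy' : 0 < y := hy
  by_cases hyT : y ∈ T
  · simp only [Set.indicator_of_mem hyT, Real.norm_eq_abs, sq_abs, smul_eq_mul, besselWeight]
    rw [← Real.rpow_natCast (_ ^ (-(α + 1 / 2))), ← Real.rpow_mul hy'.le, mul_assoc,
      ← Real.rpow_add hy']
    have : 2 * α + 1 + -(α + 1 / 2) * ((2 : ℕ) : ℝ) = 0 := by push_cast; ring
    rw [this, Real.rpow_zero, mul_one]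
  · simp [Set.indicator_of_notMem hyT]

theorem eLpNorm_le_restrict_add_compl {X : Type*} [MeasurableSpace X] {ν : Measure X}
    {f : X → ℂ} (hf : AEStronglyMeasurable f ν) {A : Set X} (hA : MeasurableSet A) :
    eLpNorm f 2 ν ≤ eLpNorm f 2 (ν.restrict A) + eLpNorm f 2 (ν.restrict Aᶜ) := by
  rw [← eLpNorm_indicator_eq_eLpNorm_restrict hA,
    ← eLpNorm_indicator_eq_eLpNorm_restrict hA.compl]
  have : f = A.indicator f + Aᶜ.indicator f := (Set.indicator_self_add_compl A f).symm
  conv_lhs => rw [this]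
  exact eLpNorm_add_le (hf.indicator hA) (hf.indicator hA.compl) (by norm_num)

/-- A bounded sequence of functions that vanish outside `S` and whose transforms asymptotically
vanish outside `T` has a convergent subsequence, if `S` and `T` have finite Lebesgue measure. -/
theorem IsFourierBesselL2.exists_subseq_tendsto {α : ℝ} (hα : -1 / 2 < α)
    {F : L2Bessel α →ₗᵢ[ℂ] L2Bessel α} (hF : IsFourierBesselL2 α F) {S T : Set ℝ}
    (hS : MeasurableSet S) (hSf : volume S < ⊤) (hT : MeasurableSet T) (hTf : volume T < ⊤)
    {g : ℕ → L2Bessel α} {M : ℝ} (hM : ∀ n, ‖g n‖ ≤ M)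
    (hgS : ∀ n, ∀ᵐ x ∂(besselMeasure α), x ∉ S → g n x = 0)
    (hgT : Tendsto (fun n => eLpNorm (F (g n)) 2 ((besselMeasure α).restrict Tᶜ)) atTop (𝓝 0)) :
    ∃ φ : ℕ → ℕ, StrictMono φ ∧ ∃ f : L2Bessel α, Tendsto (g ∘ φ) atTop (𝓝 f) := by
  have := separableSpace_L2Bessel α
  obtain ⟨φ, hφ, hweak⟩ := exists_subseq_tendsto_inner hM
  refine ⟨φ, hφ, ?_⟩
  obtain ⟨B, hB0, hB⟩ := exists_norm_fourierBessel_le hα hS hSf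
  obtain ⟨A, -, hA⟩ := exists_kernel hα
  have hFg : ∀ᵐ y ∂(besselMeasure α), ∀ n, F (g n) y = fourierBessel α (g n) y :=
    ae_all_iff.2 fun n => hF.ae_eq_fourierBessel hα hS hSf (hgS n)
  -- Evaluation of the transform at `y` is an inner product with a fixed kernel, so weak convergence
  -- gives pointwise convergence.
  have hlim : ∀ᵐ y ∂((besselMeasure α).restrict T),
      ∃ l, Tendsto (fun n => F (g (φ n)) y) atTop (𝓝 l) := by
    refine ae_restrict_of_ae ?_
    filter_upwards [hFg, ae_besselMeasure_pos α] with y h1 hy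
    obtain ⟨k, -, hk⟩ := hA S hS hSf y hy
    obtain ⟨l, hl⟩ := hweak k
    refine ⟨l, hl.congr fun n => ?_⟩
    rw [h1, hk _ (hgS _) _ (ae_eq_refl _)]
  obtain ⟨h, hh, hhlim⟩ := exists_stronglyMeasurable_limit_of_tendsto_ae
    (fun n => (Lp.aestronglyMeasurable (F (g (φ n)))).restrict) hlim
  have hG := memLp_rpow_restrict (α := α) hT hTf (B * M)
  have hbound : ∀ n, ∀ᵐ y ∂((besselMeasure α).restrict T),
      ‖F (g (φ n)) y‖ ≤ B * M * y ^ (-(α + 1 / 2)) := by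
    intro n
    refine ae_restrict_of_ae ?_
    filter_upwards [hFg, ae_besselMeasure_pos α] with y h1 hy
    rw [h1]
    refine (hB y hy _ (hgS _)).trans ?_
    calc B * y ^ (-(α + 1 / 2)) * ‖g (φ n)‖ ≤ B * y ^ (-(α + 1 / 2)) * M := by
          gcongr
          exact hM _
      _ = B * M * y ^ (-(α + 1 / 2)) := by ring
  have hdom := tendsto_eLpNorm_two_of_dominated
    (fun n => (Lp.aestronglyMeasurable (F (g (φ n)))).restrict) hh.aestronglyMeasurable hG
    hbound hhlim
  have hhmem : MemLp (T.indicator h) 2 (besselMeasure α) := by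
    rw [memLp_indicator_iff_restrict hT]
    refine hG.mono hh.aestronglyMeasurable ?_
    filter_upwards [ae_all_iff.2 hbound, hhlim] with y h1 h2
    exact (le_of_tendsto h2.norm (Eventually.of_forall h1)).trans (le_abs_self _)
  have hFlim : Tendsto (fun n => F (g (φ n))) atTop (𝓝 (hhmem.toLp _)) := by
    rw [Lp.tendsto_Lp_iff_tendsto_eLpNorm']
    -- The error is controlled on `T` by dominated convergence and off `T` by hypothesis.
    have hsum := hdom.add (hgT.comp hφ.tendsto_atTop)
    rw [add_zero] at hsum
    refine tendsto_of_tendsto_of_tendsto_of_le_of_le tendsto_const_nhds hsum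
      (fun n => zero_le) (fun n => ?_)
    refine (eLpNorm_le_restrict_add_compl ((Lp.aestronglyMeasurable _).sub
      (Lp.aestronglyMeasurable _)) hT).trans (add_le_add (le_of_eq ?_) (le_of_eq ?_))
    · refine eLpNorm_congr_ae ?_
      filter_upwards [ae_restrict_of_ae hhmem.coeFn_toLp, ae_restrict_mem hT] with y h1 h2
      rw [Pi.sub_apply, Pi.sub_apply, h1, Set.indicator_of_mem h2]
    · refine eLpNorm_congr_ae ?_
      filter_upwards [ae_restrict_of_ae hhmem.coeFn_toLp, ae_restrict_mem hT.compl] with y h1 h2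
      rw [Pi.sub_apply, h1, Set.indicator_of_notMem h2, sub_zero]
  -- An isometry reflects Cauchy sequences; surjectivity of `F` is not needed.
  have hcau : CauchySeq (g ∘ φ) := by
    have := hFlim.cauchySeq
    rw [CauchySeq, ← F.isometry.isUniformInducing.cauchy_map_iff, Filter.map_map]
    exact this
  exact cauchySeq_tendsto_of_complete hcau

/-! ### Dilations -/

theorem ae_comp_mul_left {p : ℝ → Prop} (h : ∀ᵐ x : ℝ, p x) {c : ℝ} (hc : c ≠ 0) :
    ∀ᵐ x : ℝ, p (c * x) := by
  rw [ae_iff] at h ⊢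
  have := Real.volume_preimage_mul_left hc {x | ¬p x}
  rw [h, mul_zero] at this
  exact this

theorem ae_besselMeasure_comp_mul_left {α : ℝ} {p : ℝ → Prop}
    (h : ∀ᵐ x ∂(besselMeasure α), p x) {c : ℝ} (hc : 0 < c) :
    ∀ᵐ x ∂(besselMeasure α), p (c * x) := by
  rw [ae_besselMeasure_iff] at h ⊢
  filter_upwards [ae_comp_mul_left h hc.ne'] with x hx h0
  exact hx (mul_pos hc h0)

theorem besselWeight_mul {α c x : ℝ} (hc : 0 < c) (hx : 0 < x) :
    besselWeight α x = c ^ (-(2 * α + 1)) * besselWeight α (c * x) := by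
  have h3 : c ^ (-(2 * α + 1)) * c ^ (2 * α + 1) = 1 := by
    rw [← Real.rpow_add hc, neg_add_cancel, Real.rpow_zero]
  rw [besselWeight, besselWeight, Real.mul_rpow hc.le hx.le]
  linear_combination -((2 * Real.pi) ^ (α + 1) * x ^ (2 * α + 1)) * h3

theorem memLp_comp_mul_left {α c : ℝ} (hc : 0 < c) (f : L2Bessel α) :
    MemLp (fun x => f (c * x)) 2 (besselMeasure α) := by
  have hm : StronglyMeasurable fun x => f (c * x) :=
    (Lp.stronglyMeasurable f).comp_measurable (measurable_const_mul c)
  rw [memLp_two_iff_integrable_sq_norm hm.aestronglyMeasurable, integrable_besselMeasure_iff]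
  have hf := (memLp_two_iff_integrable_sq_norm (Lp.aestronglyMeasurable f)).1 (Lp.memLp f)
  rw [integrable_besselMeasure_iff] at hf
  have h1 := (integrableOn_Ioi_comp_mul_left_iff
    (fun x => besselWeight α x • ‖f x‖ ^ 2) 0 hc).2 (by simpa using hf)
  refine IntegrableOn.congr_fun (h1.const_mul (c ^ (-(2 * α + 1)))) (fun x hx => ?_)
    measurableSet_Ioi
  simp only [smul_eq_mul]
  rw [besselWeight_mul hc hx]
  ring

/-- The kernel depends only on `x y`, and the weight is homogeneous. -/
theorem fourierBessel_comp_mul_left {α c : ℝ} (hc : 0 < c) (f : ℝ → ℂ) (y : ℝ) :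
    fourierBessel α (fun x => f (c * x)) y =
      (c ^ (-(2 * α + 1)) * c⁻¹ : ℝ) • fourierBessel α f (c⁻¹ * y) := by
  simp only [fourierBessel]
  rw [integral_besselMeasure, integral_besselMeasure]
  have := integral_comp_mul_left_Ioi (fun x => besselWeight α x •
    (f x * (besselj α (2 * Real.pi * x * (c⁻¹ * y)) : ℂ))) 0 hc
  rw [mul_zero] at this
  rw [mul_smul, ← this, ← integral_smul]
  refine setIntegral_congr_fun measurableSet_Ioi fun x hx => ?_
  rw [besselWeight_mul hc hx, mul_smul,
    show 2 * Real.pi * (c * x) * (c⁻¹ * y) = 2 * Real.pi * x * y by field_simp]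

theorem volume_preimage_mul_lt_top {S : Set ℝ} (hSf : volume S < ⊤) {c : ℝ} (hc : 0 < c) :
    volume ((fun x => c * x) ⁻¹' S) < ⊤ := by
  rw [Real.volume_preimage_mul_left hc.ne']
  exact ENNReal.mul_lt_top ENNReal.ofReal_lt_top hSf

/-- The dilates of a set of finite measure approach it in measure. -/
theorem tendsto_volume_preimage_mul_diff {S : Set ℝ} (hS : MeasurableSet S)
    (hSf : volume S < ⊤) :
    Tendsto (fun c : ℝ => volume ((fun x => c * x) ⁻¹' S \ S)) (𝓝 1) (𝓝 0) := by
  rw [ENNReal.tendsto_nhds_zero]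
  intro ε hε
  have hε3 : ε / 3 ≠ 0 := (ENNReal.div_pos hε.ne' (by simp)).ne'
  obtain ⟨K, hKS, hK, hSK⟩ := hS.exists_isCompact_sdiff_lt hSf.ne hε3
  obtain ⟨U, hKU, hU, -, hUK⟩ := hK.measurableSet.exists_isOpen_sdiff_lt
    (hK.measure_lt_top (μ := volume)).ne hε3
  -- By compactness a slightly dilated `K` stays in `U`. A point of the difference set then lies in
  -- `U \ K` or in the dilate of `S \ K`, whose measure is at most doubled because `c > 1/2`.
  have hev : ∀ᶠ c : ℝ in 𝓝 1, ∀ k ∈ K, c⁻¹ * k ∈ U := by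
    refine hK.eventually_forall_of_forall_eventually fun k hk => ?_
    have hcont : ContinuousAt (fun z : ℝ × ℝ => z.1⁻¹ * z.2) (1, k) :=
      (continuousAt_fst.inv₀ (by simp)).mul continuousAt_snd
    refine hcont.eventually_mem (hU.mem_nhds ?_)
    simpa using hKU hk
  filter_upwards [hev, lt_mem_nhds (show (1 / 2 : ℝ) < 1 by norm_num)] with c hc hc2
  have hc0 : 0 < c := by linarith
  have hsub : (fun x => c * x) ⁻¹' S \ S ⊆ (fun x => c * x) ⁻¹' (S \ K) ∪ U \ K := by
    rintro x ⟨hx1, hx2⟩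
    by_cases hxK : c * x ∈ K
    · right
      refine ⟨?_, fun h => hx2 (hKS h)⟩
      have := hc _ hxK
      rwa [inv_mul_cancel_left₀ hc0.ne'] at this
    · exact Or.inl ⟨hx1, hxK⟩
  have hci : ENNReal.ofReal |c⁻¹| ≤ 2 := by
    rw [abs_of_pos (inv_pos.2 hc0)]
    have : c⁻¹ ≤ 2 := by
      rw [inv_le_comm₀ hc0 (by norm_num)]
      linarith
    simpa using ENNReal.ofReal_le_ofReal this
  calc volume ((fun x => c * x) ⁻¹' S \ S)
      ≤ volume ((fun x => c * x) ⁻¹' (S \ K)) + volume (U \ K) :=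
        (measure_mono hsub).trans (measure_union_le _ _)
    _ ≤ 2 * (ε / 3) + ε / 3 := by
        rw [Real.volume_preimage_mul_left hc0.ne']
        gcongr
    _ = ε := by
        rw [← add_one_mul, show (2 : ENNReal) + 1 = 3 by norm_num,
          ENNReal.mul_div_cancel (by simp) (by simp)]

/-! ### Functions that vanish outside a set -/

/-- The subspace of functions in `L²_α` that vanish outside `A`. -/
noncomputable def vanishOutside (α : ℝ) (A : Set ℝ) : Submodule ℂ (L2Bessel α) where
  carrier := {g | ∀ᵐ x ∂(besselMeasure α), x ∉ A → g x = 0}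
  zero_mem' := by
    filter_upwards [Lp.coeFn_zero ℂ 2 (besselMeasure α)] with x hx _
    rw [hx]
    rfl
  add_mem' := by
    intro f g hf hg
    change ∀ᵐ x ∂(besselMeasure α), x ∉ A → (f + g) x = 0
    filter_upwards [Lp.coeFn_add f g, hf, hg] with x h1 h2 h3 hx
    rw [h1, Pi.add_apply, h2 hx, h3 hx, add_zero]
  smul_mem' := by
    intro c f hf
    change ∀ᵐ x ∂(besselMeasure α), x ∉ A → (c • f) x = 0
    filter_upwards [Lp.coeFn_smul c f, hf] with x h1 h2 hx
    rw [h1, Pi.smul_apply, h2 hx, smul_zero]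

theorem mem_vanishOutside {α : ℝ} {A : Set ℝ} {g : L2Bessel α} :
    g ∈ vanishOutside α A ↔ ∀ᵐ x ∂(besselMeasure α), x ∉ A → g x = 0 := Iff.rfl

theorem vanishOutside_mono {α : ℝ} {A B : Set ℝ} (h : A ⊆ B) :
    vanishOutside α A ≤ vanishOutside α B := by
  intro g hg
  filter_upwards [mem_vanishOutside.1 hg] with x hx hxB
  exact hx fun hA => hxB (h hA)

theorem isClosed_vanishOutside (α : ℝ) (A : Set ℝ) :
    IsClosed (vanishOutside α A : Set (L2Bessel α)) := by
  rw [← isSeqClosed_iff_isClosed]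
  intro g f hg hlim
  obtain ⟨φ, -, hφ⟩ := (tendstoInMeasure_of_tendsto_Lp hlim).exists_seq_tendsto_ae
  have hall : ∀ᵐ x ∂(besselMeasure α), ∀ n, x ∉ A → g n x = 0 := ae_all_iff.2 hg
  refine mem_vanishOutside.2 ?_
  filter_upwards [hφ, hall] with x h1 h2 hx
  refine tendsto_nhds_unique h1 ?_
  simp only [h2 _ hx]
  exact tendsto_const_nhds

theorem mem_vanishOutside_iff_eLpNorm {α : ℝ} {A : Set ℝ} (hA : MeasurableSet A)
    {g : L2Bessel α} :
    g ∈ vanishOutside α A ↔ eLpNorm g 2 ((besselMeasure α).restrict Aᶜ) = 0 := by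
  rw [eLpNorm_eq_zero_iff (Lp.aestronglyMeasurable g).restrict (by simp), mem_vanishOutside,
    EventuallyEq, ae_restrict_iff' hA.compl]
  rfl

/-- The functions vanishing outside `S` whose Fourier–Bessel transform vanishes outside `T`. -/
noncomputable def bivanishing {α : ℝ} (F : L2Bessel α →ₗᵢ[ℂ] L2Bessel α) (S T : Set ℝ) :
    Submodule ℂ (L2Bessel α) :=
  vanishOutside α S ⊓ (vanishOutside α T).comap F.toLinearMap

theorem mem_bivanishing {α : ℝ} {F : L2Bessel α →ₗᵢ[ℂ] L2Bessel α} {S T : Set ℝ}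
    {g : L2Bessel α} :
    g ∈ bivanishing F S T ↔ g ∈ vanishOutside α S ∧ F g ∈ vanishOutside α T := Iff.rfl

theorem isClosed_bivanishing {α : ℝ} (F : L2Bessel α →ₗᵢ[ℂ] L2Bessel α) (S T : Set ℝ) :
    IsClosed (bivanishing F S T : Set (L2Bessel α)) :=
  (isClosed_vanishOutside α S).inter ((isClosed_vanishOutside α T).preimage F.continuous)

/-- Riesz's theorem: the unit ball is compact by the subsequence result, the transforms vanishing
exactly off `T`. -/
theorem IsFourierBesselL2.finiteDimensional_bivanishing {α : ℝ} (hα : -1 / 2 < α)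
    {F : L2Bessel α →ₗᵢ[ℂ] L2Bessel α} (hF : IsFourierBesselL2 α F) {S T : Set ℝ}
    (hS : MeasurableSet S) (hSf : volume S < ⊤) (hT : MeasurableSet T) (hTf : volume T < ⊤) :
    FiniteDimensional ℂ (bivanishing F S T) := by
  refine FiniteDimensional.of_isCompact_closedBall ℂ (r := 1) (c := 0) one_pos ?_
  refine IsSeqCompact.isCompact ?_
  intro x hx
  have hnorm : ∀ n, ‖(x n : L2Bessel α)‖ ≤ 1 := by
    intro n
    simpa using hx n
  obtain ⟨φ, hφ, f, hf⟩ := hF.exists_subseq_tendsto hα hS hSf hT hTf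
    (g := fun n => (x n : L2Bessel α)) hnorm (fun n => (mem_bivanishing.1 (x n).2).1) (by
      have : ∀ n, eLpNorm (F (x n)) 2 ((besselMeasure α).restrict Tᶜ) = 0 := fun n =>
        (mem_vanishOutside_iff_eLpNorm hT).1 (mem_bivanishing.1 (x n).2).2
      simp only [this]
      exact tendsto_const_nhds)
  have hfmem : f ∈ bivanishing F S T :=
    (isClosed_bivanishing F S T).mem_of_tendsto hf (Eventually.of_forall fun n => (x (φ n)).2)
  refine ⟨⟨f, hfmem⟩, ?_, φ, hφ, ?_⟩
  · rw [mem_closedBall_zero_iff]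
    exact le_of_tendsto hf.norm (Eventually.of_forall fun n => hnorm (φ n))
  · rw [tendsto_subtype_rng]
    exact hf

/-- Dilation maps functions that vanish outside `S`, with transform vanishing outside `T`, to
functions that vanish outside `S / c`, with transform vanishing outside `c T`. -/
theorem IsFourierBesselL2.dilate_mem_bivanishing {α : ℝ} (hα : -1 / 2 < α)
    {F : L2Bessel α →ₗᵢ[ℂ] L2Bessel α} (hF : IsFourierBesselL2 α F) {S T : Set ℝ}
    (hS : MeasurableSet S) (hSf : volume S < ⊤) {f : L2Bessel α} (hf : f ∈ bivanishing F S T)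
    {c : ℝ} (hc : 0 < c) :
    (memLp_comp_mul_left hc f).toLp _ ∈
      bivanishing F ((fun x => c * x) ⁻¹' S) ((fun y => c⁻¹ * y) ⁻¹' T) := by
  obtain ⟨hf1, hf2⟩ := mem_bivanishing.1 hf
  set g : L2Bessel α := (memLp_comp_mul_left hc f).toLp _ with hg
  have hgae : g =ᵐ[besselMeasure α] fun x => f (c * x) := (memLp_comp_mul_left hc f).coeFn_toLp
  have hg1 : g ∈ vanishOutside α ((fun x => c * x) ⁻¹' S) := by
    refine mem_vanishOutside.2 ?_
    filter_upwards [hgae, ae_besselMeasure_comp_mul_left (mem_vanishOutside.1 hf1) hc]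
      with x h1 h2 hx
    rw [h1]
    exact h2 hx
  refine mem_bivanishing.2 ⟨hg1, mem_vanishOutside.2 ?_⟩
  -- The scaling identity is one for integrals, so `F` is replaced by the integral for both `f` and
  -- its dilate, whose supports have finite measure.
  have hFf := hF.ae_eq_fourierBessel hα hS hSf hf1
  have hFg := hF.ae_eq_fourierBessel hα (measurable_const_mul c hS)
    (volume_preimage_mul_lt_top hSf hc) hg1
  have hz : ∀ᵐ y ∂(besselMeasure α), y ∉ T → fourierBessel α f y = 0 := by
    filter_upwards [hFf, mem_vanishOutside.1 hf2] with y h1 h2 hy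
    rw [← h1, h2 hy]
  filter_upwards [hFg, ae_besselMeasure_comp_mul_left hz (inv_pos.2 hc)] with y h1 h2 hy
  have hcongr : fourierBessel α g y = fourierBessel α (fun x => f (c * x)) y := by
    refine integral_congr_ae ?_
    filter_upwards [hgae] with x hx
    rw [hx]
  rw [h1, hcongr, fourierBessel_comp_mul_left hc, h2 hy, smul_zero]

/-! ### Annihilating pairs -/

theorem volume_iUnion_le_add_tsum {S : Set ℝ} {D : ℕ → Set ℝ} {δ : ℕ → ENNReal}
    (h : ∀ n, volume (D n \ S) ≤ δ n) : volume (⋃ n, D n) ≤ volume S + ∑' n, δ n := by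
  have hsub : (⋃ n, D n) ⊆ S ∪ ⋃ n, (D n \ S) := by
    intro x hx
    obtain ⟨n, hn⟩ := Set.mem_iUnion.1 hx
    by_cases hxS : x ∈ S
    · exact Or.inl hxS
    · exact Or.inr (Set.mem_iUnion.2 ⟨n, hn, hxS⟩)
  calc volume (⋃ n, D n) ≤ volume S + volume (⋃ n, (D n \ S)) :=
        (measure_mono hsub).trans (measure_union_le _ _)
    _ ≤ volume S + ∑' n, δ n := by
        gcongr
        exact (measure_iUnion_le _).trans (ENNReal.tsum_le_tsum h)

/-- For a sequence in a finite-dimensional space, some term lies in the span of each later tail. -/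
theorem exists_mem_span_tails {K M : Type*} [Field K] [AddCommGroup M] [Module K M]
    {W : Submodule K M} [FiniteDimensional K W] {d : ℕ → M} (hd : ∀ n, d n ∈ W) :
    ∃ N₀, ∀ N, N₀ ≤ N → d N₀ ∈ Submodule.span K (Set.range fun n => d (n + N)) := by
  let w : ℕ → W := fun n => ⟨d n, hd n⟩
  let U : ℕ →o (Submodule K W)ᵒᵈ :=
    { toFun := fun N => OrderDual.toDual (Submodule.span K (Set.range fun n => w (n + N)))
      monotone' := by
        intro N M hNM
        refine OrderDual.toDual_le_toDual.2 (Submodule.span_mono ?_)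
        rintro _ ⟨n, rfl⟩
        refine ⟨n + (M - N), ?_⟩
        change w (n + (M - N) + N) = w (n + M)
        congr 1
        omega }
  -- The spans of the tails decrease, so finite dimension makes them stabilize.
  obtain ⟨N₀, hN₀⟩ := IsArtinian.monotone_stabilizes U
  refine ⟨N₀, fun N hN => ?_⟩
  have h1 : w N₀ ∈ Submodule.span K (Set.range fun n => w (n + N₀)) :=
    Submodule.subset_span ⟨0, by simp⟩
  have h2 : Submodule.span K (Set.range fun n => w (n + N₀)) =
      Submodule.span K (Set.range fun n => w (n + N)) := hN₀ N hN
  rw [h2] at h1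
  have h3 := Submodule.mem_map_of_mem (f := W.subtype) h1
  rw [Submodule.map_span, ← Set.range_comp] at h3
  exact h3

/-- If `f` is nonzero on `S`, zero outside `S`, and its transform vanishes outside `T`, then `S` is
null. Otherwise, dilates of `f` by factors close to `1` span a finite-dimensional space, so that one
of them lies in the span of the others arbitrarily far out; its support is then too large. -/
theorem IsFourierBesselL2.volume_support_eq_zero {α : ℝ} (hα : -1 / 2 < α)
    {F : L2Bessel α →ₗᵢ[ℂ] L2Bessel α} (hF : IsFourierBesselL2 α F) {S T : Set ℝ}
    (hS : MeasurableSet S) (hSf : volume S < ⊤) (hT : MeasurableSet T) (hTf : volume T < ⊤)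
    (hS0 : S ⊆ Set.Ioi 0) {f : L2Bessel α} (hf : f ∈ bivanishing F S T)
    (hfS : ∀ x ∈ S, f x ≠ 0) : volume S = 0 := by
  obtain ⟨δ, hδ0, hδ⟩ := ENNReal.exists_pos_sum_of_countable' (one_ne_zero (α := ENNReal)) ℕ
  have hδtop : ∑' n, δ n ≠ ⊤ := (hδ.trans ENNReal.one_lt_top).ne
  -- `c < 1` makes the dilated support strictly larger in measure than `S`, while the summable
  -- errors keep the union of all the dilates of finite measure.
  have hc : ∀ n, ∃ c : ℝ, 0 < c ∧ c < 1 ∧ volume ((fun x => c * x) ⁻¹' S \ S) ≤ δ n ∧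
      volume ((fun y => c⁻¹ * y) ⁻¹' T \ T) ≤ δ n := by
    intro n
    have h1 := (ENNReal.tendsto_nhds_zero.1 (tendsto_volume_preimage_mul_diff hS hSf)) _ (hδ0 n)
    have hinv : Tendsto (fun c : ℝ => c⁻¹) (𝓝 1) (𝓝 1) := by
      simpa using tendsto_inv₀ (one_ne_zero (α := ℝ))
    have h2 := hinv.eventually
      ((ENNReal.tendsto_nhds_zero.1 (tendsto_volume_preimage_mul_diff hT hTf)) _ (hδ0 n))
    have h3 : ∀ᶠ c : ℝ in 𝓝[<] 1, c < 1 := self_mem_nhdsWithin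
    obtain ⟨c, hc⟩ := ((((h1.and h2).and (lt_mem_nhds (zero_lt_one (α := ℝ)))).filter_mono
      nhdsWithin_le_nhds).and h3).exists
    exact ⟨c, hc.1.2, hc.2, hc.1.1.1, hc.1.1.2⟩
  choose c hc0 hc1 hcS hcT using hc
  set D : ℕ → Set ℝ := fun n => (fun x => c n * x) ⁻¹' S with hD
  set D' : ℕ → Set ℝ := fun n => (fun y => (c n)⁻¹ * y) ⁻¹' T with hD'
  have hDm : ∀ n, MeasurableSet (D n) := fun n => measurable_const_mul (c n) hS
  have hD'm : ∀ n, MeasurableSet (D' n) := fun n => measurable_const_mul (c n)⁻¹ hT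
  have hfin : FiniteDimensional ℂ (bivanishing F (⋃ n, D n) (⋃ n, D' n)) :=
    hF.finiteDimensional_bivanishing hα (MeasurableSet.iUnion hDm)
      ((volume_iUnion_le_add_tsum hcS).trans_lt (ENNReal.add_lt_top.2 ⟨hSf, hδtop.lt_top⟩))
      (MeasurableSet.iUnion hD'm)
      ((volume_iUnion_le_add_tsum hcT).trans_lt (ENNReal.add_lt_top.2 ⟨hTf, hδtop.lt_top⟩))
  set d : ℕ → L2Bessel α := fun n => (memLp_comp_mul_left (hc0 n) f).toLp _ with hd
  have hdmem : ∀ n, d n ∈ bivanishing F (D n) (D' n) := fun n =>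
    hF.dilate_mem_bivanishing hα hS hSf hf (hc0 n)
  have hdW : ∀ n, d n ∈ bivanishing F (⋃ n, D n) (⋃ n, D' n) := fun n =>
    mem_bivanishing.2 ⟨vanishOutside_mono (Set.subset_iUnion D n) (mem_bivanishing.1 (hdmem n)).1,
      vanishOutside_mono (Set.subset_iUnion D' n) (mem_bivanishing.1 (hdmem n)).2⟩
  obtain ⟨N₀, hN₀⟩ := exists_mem_span_tails hdW
  have hspan : ∀ N, N₀ ≤ N → d N₀ ∈ vanishOutside α (⋃ n, D (n + N)) := by
    intro N hN
    have h3 : Submodule.span ℂ (Set.range fun n => d (n + N)) ≤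
        vanishOutside α (⋃ n, D (n + N)) := by
      rw [Submodule.span_le]
      rintro _ ⟨n, rfl⟩
      exact vanishOutside_mono (Set.subset_iUnion (fun n => D (n + N)) n)
        (mem_bivanishing.1 (hdmem (n + N))).1
    exact h3 (hN₀ N hN)
  -- As `f` has no zeros on `S`, its dilate has none on `D N₀`, so up to a null set `D N₀` is
  -- covered by the supports in the tail.
  have hle : ∀ N, N₀ ≤ N → volume (D N₀) ≤ volume S + ∑' n, δ (n + N) := by
    intro N hN
    refine le_trans (measure_mono_ae ?_) (volume_iUnion_le_add_tsum (D := fun n => D (n + N))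
      (fun n => hcS (n + N)))
    have h1 := mem_vanishOutside.1 (hspan N hN)
    have h2 : d N₀ =ᵐ[besselMeasure α] fun x => f (c N₀ * x) :=
      (memLp_comp_mul_left (hc0 N₀) f).coeFn_toLp
    have h3 : ∀ᵐ x ∂(besselMeasure α), x ∉ (⋃ n, D (n + N)) → f (c N₀ * x) = 0 := by
      filter_upwards [h1, h2] with x h1 h2 hx
      rw [← h2]
      exact h1 hx
    filter_upwards [(ae_besselMeasure_iff α).1 h3] with x hx hxD
    by_contra hxU
    have hxS : c N₀ * x ∈ S := hxD
    have hpos : 0 < x := pos_of_mul_pos_right (hS0 hxS) (hc0 N₀).le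
    exact hfS _ hxS (hx hpos hxU)
  have hlim : volume (D N₀) ≤ volume S := by
    have ht : Tendsto (fun N => volume S + ∑' n, δ (n + N)) atTop (𝓝 (volume S + 0)) :=
      tendsto_const_nhds.add (ENNReal.tendsto_sum_nat_add δ hδtop)
    rw [add_zero] at ht
    refine ge_of_tendsto ht ?_
    filter_upwards [eventually_ge_atTop N₀] with N hN using hle N hN
  by_contra hne
  have hvol : volume (D N₀) = ENNReal.ofReal |(c N₀)⁻¹| * volume S :=
    Real.volume_preimage_mul_left (hc0 N₀).ne' S
  rw [hvol] at hlim
  have hgt : (1 : ENNReal) < ENNReal.ofReal |(c N₀)⁻¹| := by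
    rw [abs_of_pos (inv_pos.2 (hc0 N₀)), ENNReal.one_lt_ofReal]
    exact (one_lt_inv₀ (hc0 N₀)).2 (hc1 N₀)
  have : 1 * volume S < ENNReal.ofReal |(c N₀)⁻¹| * volume S :=
    ENNReal.mul_lt_mul_left hne hSf.ne hgt
  rw [one_mul] at this
  exact absurd hlim (not_le.2 this)

/-- Sets of finite Lebesgue measure form a weak annihilating pair. -/
theorem IsFourierBesselL2.bivanishing_eq_bot {α : ℝ} (hα : -1 / 2 < α)
    {F : L2Bessel α →ₗᵢ[ℂ] L2Bessel α} (hF : IsFourierBesselL2 α F) {S T : Set ℝ}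
    (hS : MeasurableSet S) (hSf : volume S < ⊤) (hT : MeasurableSet T) (hTf : volume T < ⊤) :
    bivanishing F S T = ⊥ := by
  rw [Submodule.eq_bot_iff]
  intro f hf
  obtain ⟨hf1, hf2⟩ := mem_bivanishing.1 hf
  -- Shrinking `S` to the actual support of `f` supplies the nonvanishing needed for the dilation
  -- argument.
  set S' : Set ℝ := S ∩ Set.Ioi 0 ∩ {x | f x ≠ 0} with hS'
  have hS'm : MeasurableSet S' := (hS.inter measurableSet_Ioi).inter
    (measurableSet_support (Lp.stronglyMeasurable f).measurable)
  have hS'S : S' ⊆ S := fun x hx => hx.1.1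
  have hfS' : f ∈ vanishOutside α S' := by
    refine mem_vanishOutside.2 ?_
    filter_upwards [mem_vanishOutside.1 hf1, ae_besselMeasure_pos α] with x h1 hx hxS'
    by_contra hne
    exact hxS' ⟨⟨by_contra fun h => hne (h1 h), hx⟩, hne⟩
  have h0 := hF.volume_support_eq_zero hα hS'm ((measure_mono hS'S).trans_lt hSf) hT hTf
    (fun x hx => hx.1.2) (mem_bivanishing.2 ⟨hfS', hf2⟩) (fun x hx => hx.2)
  refine Lp.ext ?_
  have h1 : ∀ᵐ x ∂(besselMeasure α), x ∉ S' := by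
    rw [ae_besselMeasure_iff]
    filter_upwards [measure_eq_zero_iff_ae_notMem.1 h0] with x hx _ using hx
  filter_upwards [mem_vanishOutside.1 hfS', h1, Lp.coeFn_zero ℂ 2 (besselMeasure α)]
    with x h2 h3 h4
  rw [h2 h3, h4]
  rfl

theorem normOn_Ici_diff (α : ℝ) (A : Set ℝ) (f : L2Bessel α) :
    normOn α (Set.Ici 0 \ A) f = normOn α Aᶜ f := by
  have : (besselMeasure α).restrict (Set.Ici 0 \ A) = (besselMeasure α).restrict Aᶜ := by
    refine Measure.restrict_congr_set ?_
    filter_upwards [ae_besselMeasure_pos α] with x hx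
    exact propext ⟨fun h => h.2, fun h => ⟨hx.le, h⟩⟩
  rw [normOn, this, normOn]

theorem eLpNorm_restrict_ne_top {α : ℝ} (A : Set ℝ) (f : L2Bessel α) :
    eLpNorm f 2 ((besselMeasure α).restrict A) ≠ ⊤ :=
  ((Lp.memLp f).restrict A).2.ne

theorem normOn_nonneg (α : ℝ) (A : Set ℝ) (f : L2Bessel α) : 0 ≤ normOn α A f :=
  ENNReal.toReal_nonneg

theorem normOn_le_norm {α : ℝ} (A : Set ℝ) (f : L2Bessel α) : normOn α A f ≤ ‖f‖ := by
  rw [Lp.norm_def]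
  exact ENNReal.toReal_mono (Lp.memLp f).2.ne (eLpNorm_mono_measure _ Measure.restrict_le_self)

theorem normOn_add_le {α : ℝ} (A : Set ℝ) (f g : L2Bessel α) :
    normOn α A (f + g) ≤ normOn α A f + normOn α A g := by
  rw [normOn, normOn, normOn, ← ENNReal.toReal_add (eLpNorm_restrict_ne_top A f)
    (eLpNorm_restrict_ne_top A g)]
  refine ENNReal.toReal_mono (ENNReal.add_ne_top.2
    ⟨eLpNorm_restrict_ne_top A f, eLpNorm_restrict_ne_top A g⟩) ?_
  rw [eLpNorm_congr_ae (ae_restrict_of_ae (Lp.coeFn_add f g))]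
  exact eLpNorm_add_le (Lp.aestronglyMeasurable f).restrict (Lp.aestronglyMeasurable g).restrict
    (by norm_num)

theorem normOn_smul {α : ℝ} (A : Set ℝ) (c : ℂ) (f : L2Bessel α) :
    normOn α A (c • f) = ‖c‖ * normOn α A f := by
  rw [normOn, normOn, eLpNorm_congr_ae (ae_restrict_of_ae (Lp.coeFn_smul c f)),
    eLpNorm_const_smul, ENNReal.toReal_mul, toReal_enorm]

/-- Sets of finite Lebesgue measure form a strong annihilating pair. -/
theorem isStrongAnnihilatingPair_of_volume_lt_top {α : ℝ} (hα : -1 / 2 < α) {S T : Set ℝ}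
    (hS : MeasurableSet S) (hSf : volume S < ⊤) (hT : MeasurableSet T) (hTf : volume T < ⊤) :
    IsStrongAnnihilatingPair α S T := by
  obtain ⟨F, hF⟩ := exists_isFourierBesselL2 hα
  refine ⟨F, hF, ?_⟩
  simp only [normOn_Ici_diff]
  by_contra! hcon
  -- Failure of the inequality with constant `n + 1`, after normalization.
  have hseq : ∀ n : ℕ, ∃ u : L2Bessel α, ‖u‖ = 1 ∧
      normOn α Sᶜ u + normOn α Tᶜ (F u) ≤ 1 / ((n : ℝ) + 1) := by
    intro n
    obtain ⟨f, hf⟩ := hcon ((n : ℝ) + 1)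
    have hn : (0 : ℝ) < n + 1 := by positivity
    have hf0 : 0 < ‖f‖ := lt_of_le_of_lt
      (mul_nonneg hn.le (add_nonneg (normOn_nonneg _ _ _) (normOn_nonneg _ _ _))) hf
    have hnc : ‖((‖f‖⁻¹ : ℝ) : ℂ)‖ = ‖f‖⁻¹ := by
      rw [Complex.norm_real, Real.norm_eq_abs, abs_of_pos (inv_pos.2 hf0)]
    refine ⟨((‖f‖⁻¹ : ℝ) : ℂ) • f, ?_, ?_⟩
    · rw [norm_smul, hnc, inv_mul_cancel₀ hf0.ne']
    · rw [map_smul, normOn_smul, normOn_smul, hnc, ← mul_add, inv_mul_le_iff₀ hf0, mul_one_div,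
        le_div_iff₀ hn, mul_comm]
      exact hf.le
  choose u hu1 hu using hseq
  have hzero : Tendsto (fun n : ℕ => 1 / ((n : ℝ) + 1)) atTop (𝓝 0) :=
    tendsto_one_div_add_atTop_nhds_zero_nat
  have huS : Tendsto (fun n => normOn α Sᶜ (u n)) atTop (𝓝 0) :=
    squeeze_zero (fun n => normOn_nonneg _ _ _)
      (fun n => (le_add_of_nonneg_right (normOn_nonneg _ _ _)).trans (hu n)) hzero
  have huT : Tendsto (fun n => normOn α Tᶜ (F (u n))) atTop (𝓝 0) :=
    squeeze_zero (fun n => normOn_nonneg _ _ _)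
      (fun n => (le_add_of_nonneg_left (normOn_nonneg _ _ _)).trans (hu n)) hzero
  -- The `u n` only nearly vanish off `S`. Cutting them off there costs `normOn α Sᶜ (u n)`, which
  -- tends to `0`, and allows the compactness result to be applied.
  have hmem : ∀ n, MemLp (S.indicator (u n)) 2 (besselMeasure α) :=
    fun n => (Lp.memLp (u n)).indicator hS
  set g : ℕ → L2Bessel α := fun n => (hmem n).toLp _ with hg
  have hgae : ∀ n, g n =ᵐ[besselMeasure α] S.indicator (u n) := fun n => (hmem n).coeFn_toLp
  have hgu : ∀ n, ‖g n - u n‖ = normOn α Sᶜ (u n) := by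
    intro n
    rw [Lp.norm_def, normOn, ← eLpNorm_indicator_eq_eLpNorm_restrict hS.compl]
    congr 1
    refine eLpNorm_congr_norm_ae ?_
    filter_upwards [Lp.coeFn_sub (g n) (u n), hgae n] with x h1 h2
    rw [h1, Pi.sub_apply, h2]
    by_cases hx : x ∈ S
    · simp [hx]
    · simp [hx]
  have hdiff : Tendsto (fun n => ‖g n - u n‖) atTop (𝓝 0) := by
    simp only [hgu]
    exact huS
  have hgS : ∀ n, g n ∈ vanishOutside α S := by
    intro n
    refine mem_vanishOutside.2 ?_
    filter_upwards [hgae n] with x h1 hx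
    rw [h1, Set.indicator_of_notMem hx]
  have hgM : ∀ n, ‖g n‖ ≤ 2 := by
    intro n
    have h1 : ‖g n‖ ≤ ‖g n - u n‖ + ‖u n‖ := by
      simpa using norm_add_le (g n - u n) (u n)
    have h2 : normOn α Sᶜ (u n) ≤ ‖u n‖ := normOn_le_norm _ _
    rw [hgu] at h1
    rw [hu1] at h1 h2
    linarith
  have hgT : Tendsto (fun n => normOn α Tᶜ (F (g n))) atTop (𝓝 0) := by
    have hs := hdiff.add huT
    rw [add_zero] at hs
    refine squeeze_zero (fun n => normOn_nonneg _ _ _) (fun n => ?_) hs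
    have h1 : F (g n) = F (g n - u n) + F (u n) := by
      rw [← map_add, sub_add_cancel]
    rw [h1]
    refine (normOn_add_le _ _ _).trans (add_le_add_left ?_ _)
    refine (normOn_le_norm _ _).trans (le_of_eq (F.norm_map _))
  have hgT' : Tendsto (fun n => eLpNorm (F (g n)) 2 ((besselMeasure α).restrict Tᶜ)) atTop
      (𝓝 0) := by
    have := ENNReal.tendsto_ofReal hgT
    rw [ENNReal.ofReal_zero] at this
    refine this.congr fun n => ?_
    rw [normOn, ENNReal.ofReal_toReal (eLpNorm_restrict_ne_top _ _)]
  obtain ⟨φ, hφ, f, hf⟩ := hF.exists_subseq_tendsto hα hS hSf hT hTf hgM hgS hgT'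
  have hfS : f ∈ vanishOutside α S :=
    (isClosed_vanishOutside α S).mem_of_tendsto hf (Eventually.of_forall fun n => hgS _)
  have hfT : F f ∈ vanishOutside α T := by
    rw [mem_vanishOutside_iff_eLpNorm hT]
    refine (ENNReal.toReal_eq_zero_iff _).1 ?_ |>.resolve_right (eLpNorm_restrict_ne_top _ _)
    have hs : Tendsto (fun n => ‖f - g (φ n)‖ + normOn α Tᶜ (F (g (φ n)))) atTop (𝓝 0) := by
      have h1 : Tendsto (fun n => ‖f - g (φ n)‖) atTop (𝓝 0) := by
        simpa using (tendsto_const_nhds (x := f)).sub hf |>.norm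
      simpa using h1.add (hgT.comp hφ.tendsto_atTop)
    refine le_antisymm (ge_of_tendsto' hs fun n => ?_) ENNReal.toReal_nonneg
    have h1 : F f = F (f - g (φ n)) + F (g (φ n)) := by
      rw [← map_add, sub_add_cancel]
    change normOn α Tᶜ (F f) ≤ _
    rw [h1]
    refine (normOn_add_le _ _ _).trans (add_le_add_left ?_ _)
    exact (normOn_le_norm _ _).trans (le_of_eq (F.norm_map _))
  have hf0 : f = 0 := by
    have : f ∈ bivanishing F S T := mem_bivanishing.2 ⟨hfS, hfT⟩
    rw [hF.bivanishing_eq_bot hα hS hSf hT hTf] at this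
    exact (Submodule.mem_bot ℂ).1 this
  have hnorm : Tendsto (fun n => ‖g (φ n)‖ + ‖g (φ n) - u (φ n)‖) atTop (𝓝 (‖f‖ + 0)) :=
    hf.norm.add (hdiff.comp hφ.tendsto_atTop)
  -- The unit norm of `u n` survives in the limit, contradicting `f = 0`.
  have hge : 1 ≤ ‖f‖ + 0 := by
    refine ge_of_tendsto' hnorm fun n => ?_
    rw [← hu1 (φ n)]
    simpa using norm_sub_le (g (φ n)) (g (φ n) - u (φ n))
  rw [hf0, norm_zero] at hge
  norm_num at hge

/-- For `x ≥ 1` the density is at least `(2π)^{α+1}`, and `[0, 1]` contributes at most Lebesgue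
measure `1`. -/
theorem volume_lt_top_of_besselMeasure_lt_top {α : ℝ} (hα : -1 / 2 < α) {S : Set ℝ}
    (hS : MeasurableSet S) (hS0 : S ⊆ Set.Ici 0) (h : besselMeasure α S < ⊤) :
    volume S < ⊤ := by
  have hpi := Real.pi_pos
  set a : ℝ := (2 * Real.pi) ^ (α + 1) with ha
  have ha0 : 0 < a := by positivity
  have h1 : ENNReal.ofReal a * volume (S ∩ Set.Ici 1) ≤ besselMeasure α S := by
    rw [besselMeasure_eq_withDensity_Ioi, withDensity_apply _ hS,
      Measure.restrict_restrict hS, ← setLIntegral_const]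
    refine (setLIntegral_mono_ae' (hS.inter measurableSet_Ici) (Eventually.of_forall
      fun x hx => ?_)).trans (lintegral_mono_set (t := S ∩ Set.Ioi 0) ?_)
    · refine ENNReal.ofReal_le_ofReal (le_mul_of_one_le_right ha0.le ?_)
      exact Real.one_le_rpow hx.2 (by linarith)
    · exact fun x hx => ⟨hx.1, Set.mem_Ioi.2 (zero_lt_one.trans_le hx.2)⟩
  have h2 : volume (S ∩ Set.Ici 1) < ⊤ := by
    by_contra htop
    rw [not_lt, top_le_iff] at htop
    rw [htop, ENNReal.mul_top (by simpa using ha0)] at h1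
    exact absurd (h1.trans_lt h) (lt_irrefl _)
  have hsub : S ⊆ Set.Icc 0 1 ∪ (S ∩ Set.Ici 1) := by
    intro x hx
    rcases le_total x 1 with h | h
    · exact Or.inl ⟨hS0 hx, h⟩
    · exact Or.inr ⟨hx, h⟩
  refine (measure_mono hsub).trans_lt ((measure_union_le _ _).trans_lt
    (ENNReal.add_lt_top.2 ⟨?_, h2⟩))
  simp

theorem theorem4p3 (α : ℝ) (hα : -1 / 2 < α) (S T : Set ℝ)
    (hS : MeasurableSet S) (hT : MeasurableSet T)
    (hS0 : S ⊆ Set.Ici 0) (hT0 : T ⊆ Set.Ici 0) :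
    (0 < volume S → volume S < ⊤ → 0 < volume T → volume T < ⊤ →
      IsStrongAnnihilatingPair α S T) ∧
    (besselMeasure α S < ⊤ → besselMeasure α T < ⊤ →
      IsStrongAnnihilatingPair α S T) :=
  ⟨fun _ hSf _ hTf => isStrongAnnihilatingPair_of_volume_lt_top hα hS hSf hT hTf,
    fun hSf hTf => isStrongAnnihilatingPair_of_volume_lt_top hα
      hS (volume_lt_top_of_besselMeasure_lt_top hα hS hS0 hSf)
      hT (volume_lt_top_of_besselMeasure_lt_top hα hT hT0 hTf)⟩
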